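/- Let $\ell_2$ be the Hilbert space of square-summable complex sequences with its standard orthonormal basis $(e_i)_{i\in\mathbb N}$, let $B(\ell_2)$ be the algebra of bounded linear operators on $\ell_2$, and let $\mathbb D\subset B(\ell_2)$ be the subalgebra of bounded diagonal operators, i.e. those $T$ with $\langle Te_j,e_i\rangle=0$ for all $i\ne j$. A state on $R\in\{\mathbb D,B(\ell_2)\}$ is a linear functional $f:R\to\mathbb C$ with $f(I)=1$ and $f(T)\ge 0$ for every positive operator $T\in R$; a pure state is an extreme point of the convex set of states on $R$. For $n\in\mathbb N$ let $\ell_2^n$ be $\mathbb C^n$ with the Euclidean norm and standard basis $e_1,\dots,e_n$; for an operator $T$ on $\ell_2^n$ put $\delta(T)=\max_i|\langle Te_i,e_i\rangle|$ (and $\delta(T)=0$ if $n=0$); for $A\subset\{1,\dots,n\}$ let $Q_A$ be the orthogonal projection onto the span of $\{e_i: i\in A\}$; and let $\|\cdot\|$ denote the vector norm or the operator norm. **Theorem.** The following two assertions are equivalent. 1. (Kadison--Singer, KS) Every pure state on $\mathbb D$ has a unique extension to a state on $B(\ell_2)$, and this extension is pure. 2. There exist real numbers $\delta,\varepsilon$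 with $0<\delta$ and $\sqrt\delta\le\varepsilon<1$, and a natural number $r$, such that for every $n$ and every orthogonal projection $P$ on $\ell_2^n$ with $\delta(P)\le\delta$ and $\|Pe_i\|=\|Pe_j\|$ for all $i,j\in\{1,\dots,n\}$, there is a partition $\{A_j\}_{j=1}^r$ of $\{1,\dots,n\}$ (empty parts allowed) such that $\|Q_{A_j}PQ_{A_j}\|\le 1-\varepsilon$ for all $j=1,\dots,r$. -/

import Mathlib

noncomputable section

open scoped lp ComplexOrder InnerProductSpace

namespace KadisonSinger

/-! ### The Kadison-Singer problem -/

/-- The Hilbert space `ℓ₂` of square summable complex sequences. -/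
abbrev L2 : Type := ℓ²(ℕ, ℂ)

/-- The fixed orthonormal basis `(e_i)` of `ℓ₂`. -/
abbrev e (i : ℕ) : L2 := lp.single 2 i (1 : ℂ)

lemma inner_e_left (i : ℕ) (x : L2) : ⟪e i, x⟫_ℂ = x i := by
  simp [e, lp.inner_single_left]

lemma apply_e_eq_smul {T : L2 →L[ℂ] L2} (hT : ∀ i j, i ≠ j → ⟪e i, T (e j)⟫_ℂ = 0) (j : ℕ) :
    T (e j) = (T (e j) : ∀ _, ℂ) j • e j := by
  ext i
  by_cases h : i = j
  · subst h; simp [e]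
  · have := hT i j h
    rw [inner_e_left] at this
    simp [e, this, h, lp.single_apply]

/-- The algebra `𝔻` of bounded diagonal operators on `ℓ₂`: the bounded operators whose matrix
with respect to `(e_i)` vanishes off the diagonal. -/
def diagonalAlgebra : StarSubalgebra ℂ (L2 →L[ℂ] L2) where
  carrier := {T | ∀ i j, i ≠ j → ⟪e i, T (e j)⟫_ℂ = 0}
  mul_mem' {S T} hS hT i j hij := by
    rw [mul_apply_eq_comp, apply_e_eq_smul hT j, map_smul, inner_smul_right,
      hS i j hij, mul_zero]
  add_mem' {S T} hS hT i j hij := by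
    rw [add_apply, inner_add_right, hS i j hij, hT i j hij, add_zero]
  algebraMap_mem' c i j hij := by
    rw [Algebra.algebraMap_eq_smul_one, smul_apply, inner_smul_right,
      one_apply_eq_self, inner_e_left]
    simp [e, lp.single_apply, hij]
  star_mem' {T} hT i j hij := by
    rw [ContinuousLinearMap.star_eq_adjoint, ContinuousLinearMap.adjoint_inner_right,
      ← inner_conj_symm, hT j i hij.symm, map_zero]

/-- The states of an (ordered, unital) algebra `R` of operators: the linear functionals `f` with
`f 1 = 1` and `0 ≤ f T` whenever `0 ≤ T`. For `R = B(ℋ)` and its subalgebras the order is the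
Loewner order, so that `0 ≤ T` says that `T` is a positive operator. -/
def states (R : Type*) [Ring R] [Algebra ℂ R] [PartialOrder R] : Set (R →ₗ[ℂ] ℂ) :=
  {f | f 1 = 1 ∧ ∀ T : R, 0 ≤ T → 0 ≤ f T}

/-- The pure states: the extreme points of the convex set of states. -/
def pureStates (R : Type*) [Ring R] [Algebra ℂ R] [PartialOrder R] : Set (R →ₗ[ℂ] ℂ) :=
  (states R).extremePoints ℝ

/-- The order of `𝔻` is the one of `B(ℓ₂)`: `0 ≤ T` says that `T` is a positive operator. -/
lemma diagonalAlgebra_nonneg_iff (T : diagonalAlgebra) :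
    0 ≤ T ↔ (T : L2 →L[ℂ] L2).IsPositive :=
  ContinuousLinearMap.nonneg_iff_isPositive _

/-- The functional `ψ` on `B(ℓ₂)` extends the functional `φ` on `𝔻`. -/
def Extends (ψ : (L2 →L[ℂ] L2) →ₗ[ℂ] ℂ) (φ : diagonalAlgebra →ₗ[ℂ] ℂ) : Prop :=
  ∀ T : diagonalAlgebra, ψ (T : L2 →L[ℂ] L2) = φ T

/-- **KS** (positive answer to the Kadison-Singer problem): every pure state on `𝔻` has a unique
extension to a state on `B(ℓ₂)`, and this extension is pure. -/
def KS : Prop :=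
  ∀ φ ∈ pureStates diagonalAlgebra,
    ∃ ψ ∈ pureStates (L2 →L[ℂ] L2), Extends ψ φ ∧
      ∀ ψ' ∈ states (L2 →L[ℂ] L2), Extends ψ' φ → ψ' = ψ

/-! ### Paving of projections with small constant diagonal -/

/-- The space `ℓ₂ⁿ`. -/
abbrev L2n (n : ℕ) : Type := EuclideanSpace ℂ (Fin n)

/-- The fixed orthonormal basis of `ℓ₂ⁿ`. -/
abbrev en {n : ℕ} (i : Fin n) : L2n n := EuclideanSpace.single i (1 : ℂ)

/-- `δ(T) = max_i |⟨T e_i, e_i⟩|`, the largest modulus of a diagonal entry (`0` if `n = 0`). -/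
def diagMax {n : ℕ} (T : L2n n →L[ℂ] L2n n) : ℝ :=
  ⨆ i : Fin n, ‖⟪en i, T (en i)⟫_ℂ‖

/-- The diagonal projection `Q_J`. -/
def diagProj {n : ℕ} (J : Finset (Fin n)) : L2n n →L[ℂ] L2n n :=
  Matrix.toEuclideanCLM (𝕜 := ℂ) (Matrix.diagonal fun i => if i ∈ J then (1 : ℂ) else 0)

/-- `(A_j)_{j < r}` is a paving (a partition, with empty parts allowed) of the index set. -/
def IsPaving {n r : ℕ} (A : Fin r → Finset (Fin n)) : Prop :=
  (∀ j k, j ≠ k → Disjoint (A j) (A k)) ∧ ∀ i, ∃ j, i ∈ A j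

/-- The projection-paving conjecture for orthogonal projections with small diagonal and with
`‖P e_i‖` independent of `i`, and with constants subject to `√δ ≤ ε`. The constants
`δ`, `ε`, `r` depend neither on `n` nor on `P`. -/
def EqualNormPavingConjecture : Prop :=
  ∃ (δ ε : ℝ) (r : ℕ), 0 < δ ∧ √δ ≤ ε ∧ ε < 1 ∧
    ∀ (n : ℕ) (P : L2n n →L[ℂ] L2n n), IsStarProjection P →
      diagMax P ≤ δ → (∀ i j : Fin n, ‖P (en i)‖ = ‖P (en j)‖) →
        ∃ A : Fin r → Finset (Fin n), IsPaving A ∧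
          ∀ j, ‖diagProj (A j) * P * diagProj (A j)‖ ≤ 1 - ε

end KadisonSinger

end

noncomputable section

open scoped lp ComplexOrder InnerProductSpace
open Filter Topology

namespace KadisonSinger

/-! ### Positive functionals -/

/-! From Kadison-Singer to pavings. An ultrafilter `U` on the index set gives the pure state `lim_U
⟨T e_i, e_i⟩` of `𝔻`. A diagonal operator is almost constant on suitable members of `U`, so limits
of vector states at unit vectors supported in smaller and smaller members of `U` restrict to that
same state of `𝔻`. If an operator with diagonal at most `a` had a large quadratic form on some class
of every finite coloring, some `U` would consist of bad sets only, and bad vectors would yield a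
second extension (`KS.exists_coloring`). The number of colors does not depend on the block in a
direct sum of counterexamples, and that is the required uniformity.

From pavings to Kadison-Singer. The hypothesis speaks only of equal-norm projections, and a chain of
reductions extends it, with `p` large. A positive contraction with diagonal `1/(p+1)` is a corner of
a projection with that diagonal (`exists_dilation`). A positive contraction with diagonal at most
`1/p` reaches this case by adding a diagonal operator and rescaling, at the cost of a factor
`(p+1)/p`. For a self-adjoint contraction `S` with zero diagonal, a coloring that minimizes the
monochromatic weight makes the columns of each diagonal block small, so that `(QSQ)⋆(QSQ)` has small
diagonal and can be paved. Compactness carries this to `ℓ₂`, with a factor `c = √((p+1)/p (1-ε)) <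
1`.

A pure state of `𝔻` is 0 or 1 at each `Q_A`, hence 1 at one class of each finite coloring. By
Cauchy-Schwarz an extension `ψ` satisfies `ψ S = ψ (QSQ)` for this class, and iterated paving gives
`|ψ S| ≤ c ^ N` for every `N`. So `ψ` vanishes at operators with zero diagonal and must be `φ ∘
diagPart`. -/

/-- If a positive functional vanishes at `X⋆X`, it vanishes at `Y⋆X` and `X⋆Y` for every `Y`. -/
lemma map_star_mul_eq_zero {R : Type*} [Ring R] [StarRing R] [Algebra ℂ R] [StarModule ℂ R]
    (f : R →ₗ[ℂ] ℂ) (hf : ∀ X, 0 ≤ f (star X * X)) {X : R} (hX : f (star X * X) = 0) (Y : R) :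
    f (star Y * X) = 0 ∧ f (star X * Y) = 0 := by
  have key : ∀ c : ℂ, 0 ≤ c * f (star Y * X) + star c * f (star X * Y) + f (star Y * Y) := by
    intro c
    have h := hf (c • X + Y)
    have e1 : star (c • X + Y) * (c • X + Y) =
        (star c * c) • (star X * X) + c • (star Y * X) + star c • (star X * Y) + star Y * Y := by
      simp only [star_add, star_smul, add_mul, mul_add, smul_mul_assoc, mul_smul_comm, smul_add,
        smul_smul, mul_comm c]
      abel
    rw [e1] at h
    simpa [hX] using h
  set a := f (star Y * X)
  set b := f (star X * Y)
  set q := f (star Y * Y)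
  have hq : 0 ≤ q := hf Y
  -- An affine function of a real variable that stays nonnegative has slope zero. With `c = s` and
  -- `c = s * I` in `key` this gives `a + b = 0` and `I * (a - b) = 0`.
  have real : ∀ z : ℂ, (∀ s : ℝ, 0 ≤ (s : ℂ) * z + q) → z = 0 := by
    intro z hz
    have hq' := (Complex.nonneg_iff.1 hq)
    have h1 : ∀ s : ℝ, 0 ≤ s * z.re + q.re := fun s => by
      simpa using (Complex.nonneg_iff.1 (hz s)).1
    have h2 : ∀ s : ℝ, 0 = s * z.im + q.im := fun s => by
      simpa using (Complex.nonneg_iff.1 (hz s)).2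
    apply Complex.ext
    -- This value of `s` would make the affine function equal to `-1`.
    · have h3 := h1 (-(q.re + 1) / z.re)
      by_contra hne
      have hne' : z.re ≠ 0 := hne
      rw [div_mul_cancel₀ _ hne'] at h3
      linarith
    · have := h2 0
      have := h2 1
      simp only [Complex.zero_im]
      linarith
  have hab : a + b = 0 := real _ fun s => by
    have := key s
    simp only [Complex.star_def, Complex.conj_ofReal] at this
    rwa [mul_add]
  have hab' : Complex.I * (a - b) = 0 := real _ fun s => by
    have := key (s * Complex.I)
    simp only [Complex.star_def, map_mul, Complex.conj_ofReal, Complex.conj_I] at this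
    convert this using 1
    ring
  have h3 : a - b = 0 := by simpa using hab'
  have h4 : a = 0 := by linear_combination (hab + h3) / 2
  exact ⟨h4, by linear_combination hab - h4⟩

lemma states_star_mul_self_nonneg {ψ : (L2 →L[ℂ] L2) →ₗ[ℂ] ℂ} (hψ : ψ ∈ states (L2 →L[ℂ] L2))
    (X : L2 →L[ℂ] L2) : 0 ≤ ψ (star X * X) :=
  hψ.2 _ (star_mul_self_nonneg X)

lemma states_diagonalAlgebra_star_mul_self_nonneg {φ : diagonalAlgebra →ₗ[ℂ] ℂ}
    (hφ : φ ∈ states diagonalAlgebra) (X : diagonalAlgebra) : 0 ≤ φ (star X * X) :=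
  hφ.2 _ (star_mul_self_nonneg (X : L2 →L[ℂ] L2))

/-- A state is real and bounded by the norm at self-adjoint operators. -/
lemma norm_map_le_of_isSelfAdjoint {ψ : (L2 →L[ℂ] L2) →ₗ[ℂ] ℂ} (hψ : ψ ∈ states (L2 →L[ℂ] L2))
    {S : L2 →L[ℂ] L2} (hS : IsSelfAdjoint S) : ‖ψ S‖ ≤ ‖S‖ := by
  have h1 : S ≤ (‖S‖ : ℂ) • 1 := by
    refine hS.le_algebraMap_norm_self.trans_eq ?_
    ext x : 1
    exact (Complex.coe_smul _ _).symm
  have h2 : -((‖S‖ : ℂ) • 1) ≤ S := by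
    refine Eq.trans_le ?_ hS.neg_algebraMap_norm_le_self
    ext x : 1
    exact congrArg Neg.neg (Complex.coe_smul _ _)
  replace h1 := hψ.2 _ (sub_nonneg.2 h1)
  replace h2 := hψ.2 _ (neg_le_iff_add_nonneg.1 h2)
  have h3 : ψ ((‖S‖ : ℂ) • 1) = (‖S‖ : ℂ) := by
    rw [map_smul, hψ.1, smul_eq_mul, mul_one]
  rw [map_sub, h3] at h1
  rw [map_add, h3] at h2
  have h1' := Complex.nonneg_iff.1 h1
  have h2' := Complex.nonneg_iff.1 h2
  have him : (ψ S).im = 0 := by simpa using h1'.2.symm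
  have hre : ψ S = ((ψ S).re : ℂ) := Complex.ext rfl (by simpa using him)
  rw [hre, Complex.norm_real, Real.norm_eq_abs, abs_le]
  constructor
  · have := h2'.1; simp at this; linarith
  · have := h1'.1; simp at this; linarith

/-! ### The space `ℓ₂` and diagonal operators -/

lemma norm_e (i : ℕ) : ‖e i‖ = 1 := by
  simp [e, lp.norm_single]

lemma orthonormal_e : Orthonormal ℂ e := by
  refine ⟨norm_e, fun i j hij => ?_⟩
  change ⟪e i, e j⟫_ℂ = 0
  rw [inner_e_left]
  simp [e, lp.single_apply, hij]

lemma hasSum_e (x : L2) : HasSum (fun i => x i • e i) x := by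
  have := lp.hasSum_single (p := 2) (by simp) x
  convert this using 2 with i
  ext j
  simp [e, lp.single_apply, Pi.single_apply]

lemma norm_le_of_forall_norm_apply_le {x y : L2} {c : ℝ} (hc : 0 ≤ c)
    (h : ∀ i, ‖y i‖ ≤ c * ‖x i‖) : ‖y‖ ≤ c * ‖x‖ := by
  refine lp.norm_le_of_forall_sum_le (by norm_num) (by positivity) fun s => ?_
  calc ∑ i ∈ s, ‖y i‖ ^ (2 : ENNReal).toReal
      ≤ ∑ i ∈ s, c ^ (2 : ENNReal).toReal * ‖x i‖ ^ (2 : ENNReal).toReal := by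
        refine Finset.sum_le_sum fun i _ => ?_
        rw [← Real.mul_rpow hc (norm_nonneg _)]
        exact Real.rpow_le_rpow (norm_nonneg _) (h i) (by norm_num)
    _ ≤ (c * ‖x‖) ^ (2 : ENNReal).toReal := by
        rw [← Finset.mul_sum, Real.mul_rpow hc (norm_nonneg _)]
        gcongr
        exact lp.sum_rpow_le_norm_rpow (by norm_num) x s

lemma apply_eq_of_mem_diagonalAlgebra {T : L2 →L[ℂ] L2} (hT : T ∈ diagonalAlgebra) (x : L2)
    (i : ℕ) : T x i = ⟪e i, T (e i)⟫_ℂ * x i := by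
  have hT' : star T ∈ diagonalAlgebra := star_mem hT
  have h := apply_e_eq_smul hT' i
  rw [← inner_e_left i (T x), ← ContinuousLinearMap.adjoint_inner_left,
    ← ContinuousLinearMap.star_eq_adjoint, h, inner_smul_left, inner_e_left,
    ← inner_e_left i (star T (e i)), ContinuousLinearMap.star_eq_adjoint,
    ContinuousLinearMap.adjoint_inner_right, inner_conj_symm]

lemma memℓp_mul {d : ℕ → ℂ} {C : ℝ} (hC : ∀ i, ‖d i‖ ≤ C) (x : L2) :
    Memℓp (fun i => d i * x i) 2 := by
  have h : Memℓp (fun i => (C : ℂ) * x i) 2 := Memℓp.const_mul (lp.memℓp x) (C : ℂ)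
  refine h.mono' fun i => ?_
  have hC0 : 0 ≤ C := (norm_nonneg _).trans (hC i)
  rw [norm_mul, norm_mul, Complex.norm_real, Real.norm_of_nonneg hC0]
  exact mul_le_mul_of_nonneg_right (hC i) (norm_nonneg _)

/-- The linear map of multiplication with a bounded sequence. -/
def diagMap (d : ℕ → ℂ) (C : ℝ) (hC : ∀ i, ‖d i‖ ≤ C) : L2 →ₗ[ℂ] L2 where
  toFun x := ⟨fun i => d i * x i, memℓp_mul hC x⟩
  map_add' x y := by
    ext i
    exact mul_add (d i) (x i) (y i)
  map_smul' c x := by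
    ext i
    exact mul_left_comm (d i) c (x i)

/-- The operator of multiplication with a bounded sequence. -/
def diagOp (d : ℕ → ℂ) (C : ℝ) (hC : ∀ i, ‖d i‖ ≤ C) : L2 →L[ℂ] L2 :=
  (diagMap d C hC).mkContinuous C fun x =>
    norm_le_of_forall_norm_apply_le ((norm_nonneg _).trans (hC 0)) fun i => by
      change ‖d i * x i‖ ≤ _
      rw [norm_mul]
      exact mul_le_mul_of_nonneg_right (hC i) (norm_nonneg _)

@[simp]
lemma diagOp_apply (d : ℕ → ℂ) (C : ℝ) (hC : ∀ i, ‖d i‖ ≤ C) (x : L2) (i : ℕ) :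
    diagOp d C hC x i = d i * x i := rfl

lemma diagOp_mem (d : ℕ → ℂ) (C : ℝ) (hC : ∀ i, ‖d i‖ ≤ C) : diagOp d C hC ∈ diagonalAlgebra := by
  intro i j hij
  rw [inner_e_left, diagOp_apply]
  simp [e, lp.single_apply, hij]

lemma inner_e_diagOp (d : ℕ → ℂ) (C : ℝ) (hC : ∀ i, ‖d i‖ ≤ C) (i : ℕ) :
    ⟪e i, diagOp d C hC (e i)⟫_ℂ = d i := by
  rw [inner_e_left, diagOp_apply]
  simp [e]

lemma norm_inner_e_le (T : L2 →L[ℂ] L2) (i : ℕ) : ‖⟪e i, T (e i)⟫_ℂ‖ ≤ ‖T‖ := by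
  refine (norm_inner_le_norm _ _).trans ?_
  rw [norm_e, one_mul]
  exact T.le_of_opNorm_le_of_le le_rfl (norm_e i).le |>.trans (by simp)

/-- Elements of the diagonal algebra are determined by their diagonal entries. -/
lemma eq_of_mem_diagonalAlgebra {S T : L2 →L[ℂ] L2} (hS : S ∈ diagonalAlgebra)
    (hT : T ∈ diagonalAlgebra) (h : ∀ i, ⟪e i, S (e i)⟫_ℂ = ⟪e i, T (e i)⟫_ℂ) : S = T := by
  ext x i
  rw [apply_eq_of_mem_diagonalAlgebra hS, apply_eq_of_mem_diagonalAlgebra hT, h]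

lemma diagonalAlgebra_nonneg {T : diagonalAlgebra}
    (h : ∀ i, 0 ≤ ⟪e i, (T : L2 →L[ℂ] L2) (e i)⟫_ℂ) : 0 ≤ T := by
  rw [diagonalAlgebra_nonneg_iff, ContinuousLinearMap.isPositive_iff_complex]
  intro x
  have h1 : 0 ≤ ⟪x, (T : L2 →L[ℂ] L2) x⟫_ℂ := by
    rw [lp.inner_eq_tsum]
    refine tsum_nonneg fun i => ?_
    rw [apply_eq_of_mem_diagonalAlgebra T.2]
    have h2 : 0 ≤ ⟪x i, x i⟫_ℂ := mul_star_self_nonneg (x i)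
    have := mul_nonneg (h i) h2
    rwa [← inner_smul_right, smul_eq_mul] at this
  have h2 : 0 ≤ ⟪(T : L2 →L[ℂ] L2) x, x⟫_ℂ := by
    rw [← inner_conj_symm]
    exact star_nonneg_iff.2 h1
  have h3 := Complex.nonneg_iff.1 h2
  exact ⟨Complex.ext rfl (by simpa using h3.2), h3.1⟩

/-- The diagonal part of an operator, as a linear map onto the diagonal algebra. -/
def diagPart : (L2 →L[ℂ] L2) →ₗ[ℂ] diagonalAlgebra where
  toFun T := ⟨diagOp (fun i => ⟪e i, T (e i)⟫_ℂ) ‖T‖ (norm_inner_e_le T), diagOp_mem _ _ _⟩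
  map_add' S T := by
    ext x i
    simp [add_mul]
  map_smul' c T := by
    ext x i
    simp [mul_assoc]

lemma inner_e_diagPart (T : L2 →L[ℂ] L2) (i : ℕ) :
    ⟪e i, (diagPart T : L2 →L[ℂ] L2) (e i)⟫_ℂ = ⟪e i, T (e i)⟫_ℂ :=
  inner_e_diagOp _ _ _ i

lemma diagPart_coe (T : diagonalAlgebra) : diagPart (T : L2 →L[ℂ] L2) = T :=
  Subtype.ext (eq_of_mem_diagonalAlgebra (diagPart _).2 T.2 fun i => inner_e_diagPart _ i)

lemma diagPart_nonneg {T : L2 →L[ℂ] L2} (hT : 0 ≤ T) : 0 ≤ diagPart T :=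
  diagonalAlgebra_nonneg fun i => by
    rw [inner_e_diagPart]
    exact ((ContinuousLinearMap.nonneg_iff_isPositive _).1 hT).inner_nonneg_right _

open Classical in
/-- The diagonal projection `Q_A` on `ℓ₂`. -/
def coordProj (A : Set ℕ) : L2 →L[ℂ] L2 :=
  diagOp (fun i => if i ∈ A then 1 else 0) 1 fun i => by split_ifs <;> simp

lemma coordProj_mem (A : Set ℕ) : coordProj A ∈ diagonalAlgebra := diagOp_mem _ _ _

open Classical in
lemma coordProj_apply (A : Set ℕ) (x : L2) (i : ℕ) :
    coordProj A x i = if i ∈ A then x i else 0 := by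
  simp [coordProj]

lemma isSelfAdjoint_coordProj (A : Set ℕ) : IsSelfAdjoint (coordProj A) := by
  refine eq_of_mem_diagonalAlgebra (star_mem (coordProj_mem A)) (coordProj_mem A) fun i => ?_
  rw [ContinuousLinearMap.star_eq_adjoint, ContinuousLinearMap.adjoint_inner_right,
    ← inner_conj_symm, coordProj, inner_e_diagOp]
  split_ifs <;> simp

lemma coordProj_mul_self (A : Set ℕ) : coordProj A * coordProj A = coordProj A := by
  ext x i
  rw [mul_apply_eq_comp, coordProj_apply, coordProj_apply]
  split_ifs <;> rfl

lemma coordProj_add_compl (A : Set ℕ) : coordProj A + coordProj Aᶜ = 1 := by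
  ext x i
  simp only [_root_.add_apply, lp.coeFn_add, Pi.add_apply, coordProj_apply]
  by_cases h : i ∈ A <;> simp [h]

/-! ### Limits of vector states -/

lemma exists_tendsto_inner {𝓕 : Ultrafilter L2} (h : ∀ᶠ x in (𝓕 : Filter L2), ‖x‖ = 1) (T : L2 →L[ℂ] L2) :
    ∃ c, Tendsto (fun x => ⟪x, T x⟫_ℂ) 𝓕 (𝓝 c) := by
  have hb : (𝓕.map fun x => ⟪x, T x⟫_ℂ : Filter ℂ) ≤ 𝓟 (Metric.closedBall 0 ‖T‖) := by
    rw [le_principal_iff, Ultrafilter.mem_coe, Ultrafilter.mem_map]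
    filter_upwards [h] with x hx
    rw [Set.mem_preimage, mem_closedBall_zero_iff]
    calc ‖⟪x, T x⟫_ℂ‖ ≤ ‖x‖ * ‖T x‖ := norm_inner_le_norm _ _
      _ ≤ ‖x‖ * (‖T‖ * ‖x‖) := by gcongr; exact T.le_opNorm x
      _ = ‖T‖ := by rw [hx]; ring
  obtain ⟨c, -, hc⟩ := (isCompact_closedBall (0 : ℂ) ‖T‖).ultrafilter_le_nhds _ hb
  exact ⟨c, hc⟩

/-- The limit of the vector states along an ultrafilter of unit vectors. -/
def limitState (𝓕 : Ultrafilter L2) (h : ∀ᶠ x in (𝓕 : Filter L2), ‖x‖ = 1) : (L2 →L[ℂ] L2) →ₗ[ℂ] ℂ where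
  toFun T := (exists_tendsto_inner h T).choose
  map_add' S T := by
    refine tendsto_nhds_unique (exists_tendsto_inner h (S + T)).choose_spec ?_
    simpa only [_root_.add_apply, inner_add_right] using
      (exists_tendsto_inner h S).choose_spec.add (exists_tendsto_inner h T).choose_spec
  map_smul' c T := by
    refine tendsto_nhds_unique (exists_tendsto_inner h (c • T)).choose_spec ?_
    simpa only [_root_.smul_apply, inner_smul_right, RingHom.id_apply, smul_eq_mul] using
      (exists_tendsto_inner h T).choose_spec.const_mul c

lemma tendsto_limitState (𝓕 : Ultrafilter L2) (h : ∀ᶠ x in (𝓕 : Filter L2), ‖x‖ = 1) (T : L2 →L[ℂ] L2) :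
    Tendsto (fun x => ⟪x, T x⟫_ℂ) 𝓕 (𝓝 (limitState 𝓕 h T)) :=
  (exists_tendsto_inner h T).choose_spec

lemma limitState_mem_states (𝓕 : Ultrafilter L2) (h : ∀ᶠ x in (𝓕 : Filter L2), ‖x‖ = 1) :
    limitState 𝓕 h ∈ states (L2 →L[ℂ] L2) := by
  constructor
  · refine tendsto_nhds_unique (tendsto_limitState 𝓕 h 1) (tendsto_const_nhds.congr' ?_)
    filter_upwards [h] with x hx
    rw [one_apply_eq_self, inner_self_eq_norm_sq_to_K, hx]
    simp
  · intro T hT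
    exact ge_of_tendsto' (tendsto_limitState 𝓕 h T) fun x =>
      ((ContinuousLinearMap.nonneg_iff_isPositive _).1 hT).inner_nonneg_right x

/-- The restriction of a functional on `B(ℓ₂)` to `𝔻`. -/
def restrict (ψ : (L2 →L[ℂ] L2) →ₗ[ℂ] ℂ) : diagonalAlgebra →ₗ[ℂ] ℂ :=
  ψ.comp diagonalAlgebra.toSubalgebra.val.toLinearMap

@[simp]
lemma restrict_apply (ψ : (L2 →L[ℂ] L2) →ₗ[ℂ] ℂ) (T : diagonalAlgebra) :
    restrict ψ T = ψ (T : L2 →L[ℂ] L2) := rfl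

lemma restrict_mem_states {ψ : (L2 →L[ℂ] L2) →ₗ[ℂ] ℂ} (hψ : ψ ∈ states (L2 →L[ℂ] L2)) :
    restrict ψ ∈ states diagonalAlgebra :=
  ⟨hψ.1, fun T hT => hψ.2 (T : L2 →L[ℂ] L2) hT⟩

/-- A state of `𝔻` without variance is pure. -/
lemma mem_pureStates_of_variance_eq_zero {φ : diagonalAlgebra →ₗ[ℂ] ℂ}
    (hφ : φ ∈ states diagonalAlgebra)
    (h : ∀ T, φ (star (T - φ T • 1) * (T - φ T • 1)) = 0) : φ ∈ pureStates diagonalAlgebra := by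
  refine ⟨hφ, ?_⟩
  rintro f₁ hf₁ f₂ hf₂ ⟨a, b, ha, hb, -, hab⟩
  refine LinearMap.ext fun T => ?_
  set X := T - φ T • (1 : diagonalAlgebra)
  have h1 := states_diagonalAlgebra_star_mul_self_nonneg hf₁ X
  have h2 := states_diagonalAlgebra_star_mul_self_nonneg hf₂ X
  have h3 : (a : ℂ) * f₁ (star X * X) + (b : ℂ) * f₂ (star X * X) = 0 := by
    have h4 : (a • f₁ + b • f₂) (star X * X) = 0 := by
      rw [hab]
      exact h T
    exact h4
  have h4 : f₁ (star X * X) = 0 := by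
    have ha' : (0 : ℂ) < a := by exact_mod_cast ha
    have hb' : (0 : ℂ) < b := by exact_mod_cast hb
    have h5 := mul_nonneg ha'.le h1
    have h6 := mul_nonneg hb'.le h2
    have h7 := (add_eq_zero_iff_of_nonneg h5 h6).1 h3
    exact (mul_eq_zero.1 h7.1).resolve_left ha'.ne'
  -- Cauchy-Schwarz against `1`: as `f₁` has no variance about `φ T`, its mean at `T` is `φ T`.
  have h5 := (map_star_mul_eq_zero f₁ (states_diagonalAlgebra_star_mul_self_nonneg hf₁) h4 1).1
  rw [star_one, one_mul, map_sub, map_smul, hf₁.1, smul_eq_mul, mul_one] at h5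
  exact sub_eq_zero.1 h5

lemma eventually_map_e_norm (U : Ultrafilter ℕ) : ∀ᶠ x in (U.map e : Filter L2), ‖x‖ = 1 := by
  rw [Ultrafilter.coe_map, eventually_map]
  exact Eventually.of_forall norm_e

/-- The state `T ↦ lim_U ⟨T e_i, e_i⟩`. -/
def basisState (U : Ultrafilter ℕ) : (L2 →L[ℂ] L2) →ₗ[ℂ] ℂ :=
  limitState (U.map e) (eventually_map_e_norm U)

lemma tendsto_basisState (U : Ultrafilter ℕ) (T : L2 →L[ℂ] L2) :
    Tendsto (fun i => ⟪e i, T (e i)⟫_ℂ) U (𝓝 (basisState U T)) := by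
  have := tendsto_limitState (U.map e) (eventually_map_e_norm U) T
  rwa [Ultrafilter.coe_map, tendsto_map'_iff] at this

lemma basisState_mem_states (U : Ultrafilter ℕ) : basisState U ∈ states (L2 →L[ℂ] L2) :=
  limitState_mem_states _ _

/-- On diagonal operators the limit along `U` is multiplicative: the entries of `X⋆X` are the
squared moduli of those of `X`, so they tend to 0 once `T` is centered at its limit. Hence there is
no variance. -/
lemma restrict_basisState_mem_pureStates (U : Ultrafilter ℕ) :
    restrict (basisState U) ∈ pureStates diagonalAlgebra := by
  refine mem_pureStates_of_variance_eq_zero (restrict_mem_states (basisState_mem_states U)) ?_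
  intro T
  set c := restrict (basisState U) T with hc
  set X : diagonalAlgebra := T - c • (1 : diagonalAlgebra) with hX
  have hXi : ∀ i, ⟪e i, (X : L2 →L[ℂ] L2) (e i)⟫_ℂ = ⟪e i, (T : L2 →L[ℂ] L2) (e i)⟫_ℂ - c := by
    intro i
    have : (X : L2 →L[ℂ] L2) (e i) = (T : L2 →L[ℂ] L2) (e i) - c • e i := rfl
    rw [this, inner_sub_right, inner_smul_right, inner_self_eq_norm_sq_to_K, norm_e]
    simp
  have hlim : Tendsto (fun i => ⟪e i, (X : L2 →L[ℂ] L2) (e i)⟫_ℂ) U (𝓝 0) := by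
    simp only [hXi]
    have := (tendsto_basisState U (T : L2 →L[ℂ] L2)).sub_const c
    rwa [hc, restrict_apply, sub_self] at this
  refine tendsto_nhds_unique (tendsto_basisState U _) ?_
  have h2 : Tendsto (fun i => star ⟪e i, (X : L2 →L[ℂ] L2) (e i)⟫_ℂ *
      ⟪e i, (X : L2 →L[ℂ] L2) (e i)⟫_ℂ) U (𝓝 0) := by
    simpa using (hlim.star).mul hlim
  refine h2.congr fun i => ?_
  have hXe : (X : L2 →L[ℂ] L2) (e i) = ⟪e i, (X : L2 →L[ℂ] L2) (e i)⟫_ℂ • e i := by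
    rw [inner_e_left]
    exact apply_e_eq_smul X.2 i
  change _ = ⟪e i, ContinuousLinearMap.adjoint (X : L2 →L[ℂ] L2) ((X : L2 →L[ℂ] L2) (e i))⟫_ℂ
  rw [ContinuousLinearMap.adjoint_inner_right]
  nth_rw 3 [hXe]
  nth_rw 3 [hXe]
  rw [inner_smul_left, inner_smul_right, inner_self_eq_norm_sq_to_K, norm_e]
  simp

/-! ### From Kadison-Singer to pavings -/

lemma norm_diagonal_apply_le {T : L2 →L[ℂ] L2} (hT : T ∈ diagonalAlgebra) {x : L2} {η : ℝ}
    (hη : 0 ≤ η) (h : ∀ i, x i ≠ 0 → ‖⟪e i, T (e i)⟫_ℂ‖ ≤ η) : ‖T x‖ ≤ η * ‖x‖ := by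
  refine norm_le_of_forall_norm_apply_le hη fun i => ?_
  rw [apply_eq_of_mem_diagonalAlgebra hT, norm_mul]
  by_cases hx : x i = 0
  · simp [hx]
  · exact mul_le_mul_of_nonneg_right (h i hx) (norm_nonneg _)

/-- If each member of `U` carries a unit vector in `K`, some state extends the restriction of
`basisState U` and is a limit of vector states at vectors in `K`. -/
lemma exists_limitState_extends (U : Ultrafilter ℕ) (K : Set L2)
    (hK : ∀ A ∈ U, ∃ x ∈ K, ‖x‖ = 1 ∧ ∀ i ∉ A, x i = 0) :
    ∃ (𝓖 : Ultrafilter L2) (h : ∀ᶠ x in (𝓖 : Filter L2), ‖x‖ = 1), K ∈ 𝓖 ∧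
      Extends (limitState 𝓖 h) (restrict (basisState U)) := by
  -- These sets are nonempty by `hK` and directed under intersection of the `A`, so they generate a
  -- proper filter; any ultrafilter below it will serve.
  let s : {A // A ∈ U} → Set L2 := fun A => {x | x ∈ K ∧ ‖x‖ = 1 ∧ ∀ i ∉ A.1, x i = 0}
  have hmono : ∀ A B : {A // A ∈ U}, A.1 ⊆ B.1 → s A ⊆ s B := fun A B hAB x hx =>
    ⟨hx.1, hx.2.1, fun i hi => hx.2.2 i fun hA => hi (hAB hA)⟩
  have : Nonempty {A // A ∈ U} := ⟨⟨_, univ_mem⟩⟩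
  have hne : NeBot (⨅ A, 𝓟 (s A)) := by
    refine iInf_neBot_of_directed (fun A B => ?_) fun A => ?_
    · refine ⟨⟨A.1 ∩ B.1, inter_mem A.2 B.2⟩, ?_, ?_⟩
      · exact principal_mono.2 (hmono _ _ Set.inter_subset_left)
      · exact principal_mono.2 (hmono _ _ Set.inter_subset_right)
    · rw [principal_neBot_iff]
      obtain ⟨x, hx⟩ := hK A.1 A.2
      exact ⟨x, hx⟩
  have hs : ∀ A : {A // A ∈ U}, s A ∈ Ultrafilter.of (⨅ A, 𝓟 (s A)) := fun A =>
    Ultrafilter.of_le _ (mem_iInf_of_mem A (mem_principal_self _))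
  have h0 := hs ⟨_, univ_mem⟩
  have hnorm : ∀ᶠ x in (Ultrafilter.of (⨅ A, 𝓟 (s A)) : Filter L2), ‖x‖ = 1 :=
    mem_of_superset h0 fun x hx => hx.2.1
  refine ⟨_, hnorm, mem_of_superset h0 fun x hx => hx.1, fun T => ?_⟩
  refine tendsto_nhds_unique (tendsto_limitState _ hnorm _) ?_
  rw [Metric.tendsto_nhds]
  intro η hη
  set c := restrict (basisState U) T
  -- On this member of `U` the entries of `T - c` are at most `η / 2`, which bounds `T - c` on all
  -- vectors supported there.
  have hA : {i | ‖⟪e i, (T : L2 →L[ℂ] L2) (e i)⟫_ℂ - c‖ ≤ η / 2} ∈ U := by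
    have := (Metric.tendsto_nhds.1 (tendsto_basisState U (T : L2 →L[ℂ] L2))) (η / 2) (by positivity)
    filter_upwards [this] with i hi
    rw [dist_eq_norm] at hi
    exact hi.le
  filter_upwards [hs ⟨_, hA⟩] with x hx
  obtain ⟨-, hx1, hx2⟩ := hx
  set X : diagonalAlgebra := T - c • (1 : diagonalAlgebra) with hX
  have hXapp : ∀ y, (X : L2 →L[ℂ] L2) y = (T : L2 →L[ℂ] L2) y - c • y := fun y => rfl
  have h1 : ‖(X : L2 →L[ℂ] L2) x‖ ≤ η / 2 * ‖x‖ := by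
    refine norm_diagonal_apply_le X.2 (by positivity) fun i hi => ?_
    rw [hXapp, inner_sub_right, inner_smul_right, inner_self_eq_norm_sq_to_K, norm_e]
    by_contra hc
    exact hi (hx2 i fun hi' => hc (by simpa using hi'))
  have h2 : ⟪x, (T : L2 →L[ℂ] L2) x⟫_ℂ - c = ⟪x, (X : L2 →L[ℂ] L2) x⟫_ℂ := by
    rw [hXapp, inner_sub_right, inner_smul_right, inner_self_eq_norm_sq_to_K, hx1]
    simp
  rw [dist_eq_norm, h2]
  calc _ ≤ ‖x‖ * ‖(X : L2 →L[ℂ] L2) x‖ := norm_inner_le_norm _ _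
    _ ≤ η / 2 := by rw [hx1] at h1 ⊢; linarith
    _ < η := by linarith

/-- Under KS, an operator with diagonal at most `a` has a finite coloring of the basis such that
its quadratic form is at most `b > a` on each color class. -/
theorem KS.exists_coloring (hKS : KS) (P : L2 →L[ℂ] L2) {a b : ℝ} (hab : a < b)
    (hP : ∀ i, (⟪e i, P (e i)⟫_ℂ).re ≤ a) :
    ∃ (k : ℕ) (g : ℕ → Fin k), ∀ j, ∀ x : L2, (∀ i, g i ≠ j → x i = 0) →
      (⟪x, P x⟫_ℂ).re ≤ b * ‖x‖ ^ 2 := by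
  by_contra! hcon
  let Good : Set ℕ → Prop := fun A =>
    ∀ x : L2, (∀ i ∉ A, x i = 0) → (⟪x, P x⟫_ℂ).re ≤ b * ‖x‖ ^ 2
  -- Complements of good sets have the finite intersection property: if finitely many had empty
  -- intersection, coloring each `i` by one of them that misses `i` would give a finite coloring
  -- with good classes only. The resulting `U` has no good member.
  obtain ⟨U, hU⟩ := Ultrafilter.exists_ultrafilter_of_finite_inter_nonempty
    {B : Set ℕ | Good Bᶜ} (by
      intro T hT
      by_contra hne
      have hex : ∀ i : ℕ, ∃ B : T, i ∉ B.1 := by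
        intro i
        by_contra! hi
        exact hne ⟨i, fun B hB => hi ⟨B, hB⟩⟩
      choose g hg using hex
      obtain ⟨j, x, hx, hlt⟩ := hcon _ fun i => T.equivFin (g i)
      refine absurd (hT (T.equivFin.symm j).2 x fun i hi => hx i fun hij => hi ?_) (not_le.2 hlt)
      rw [← hij, Equiv.symm_apply_apply]
      exact hg i)
  have hbad : ∀ A ∈ U, ∃ x ∈ {x : L2 | b ≤ (⟪x, P x⟫_ℂ).re}, ‖x‖ = 1 ∧ ∀ i ∉ A, x i = 0 := by
    intro A hA
    have hnot : ¬ Good A := fun hG => by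
      have : Aᶜ ∈ U := hU (by simpa using hG)
      exact Ultrafilter.compl_notMem_iff.2 hA this
    simp only [Good] at hnot
    push Not at hnot
    obtain ⟨x, hx, hlt⟩ := hnot
    have hx0 : x ≠ 0 := by
      rintro rfl
      simp at hlt
    have hn : 0 < ‖x‖ := norm_pos_iff.2 hx0
    refine ⟨((‖x‖⁻¹ : ℝ) : ℂ) • x, ?_, ?_, fun i hi => ?_⟩
    · change b ≤ _
      rw [map_smul, inner_smul_left, inner_smul_right, Complex.conj_ofReal, ← mul_assoc,
        ← Complex.ofReal_mul, Complex.re_ofReal_mul]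
      calc b = ‖x‖⁻¹ * ‖x‖⁻¹ * (b * ‖x‖ ^ 2) := by field_simp
        _ ≤ _ := by gcongr
    · rw [norm_smul, Complex.norm_real, norm_inv, norm_norm, inv_mul_cancel₀ hn.ne']
    · simp [hx i hi]
  obtain ⟨𝓖, h𝓖, hK, hext⟩ := exists_limitState_extends U _ hbad
  obtain ⟨ψ, -, -, huniq⟩ := hKS _ (restrict_basisState_mem_pureStates U)
  -- Two extensions of one pure state must coincide, yet at `P` one has real part at least `b` and
  -- the other at most `a`.
  have heq : limitState 𝓖 h𝓖 = basisState U :=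
    (huniq _ (limitState_mem_states _ _) hext).trans
      (huniq _ (basisState_mem_states U) fun T => rfl).symm
  have h1 : b ≤ (limitState 𝓖 h𝓖 P).re :=
    ge_of_tendsto (Complex.continuous_re.continuousAt.tendsto.comp (tendsto_limitState 𝓖 h𝓖 P)) hK
  have h2 : (basisState U P).re ≤ a :=
    le_of_tendsto' (Complex.continuous_re.continuousAt.tendsto.comp (tendsto_basisState U P)) hP
  rw [heq] at h1
  linarith

/-! ### Finite-dimensional compressions -/

lemma diagProj_apply {n : ℕ} (J : Finset (Fin n)) (x : L2n n) (i : Fin n) :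
    diagProj J x i = if i ∈ J then x i else 0 := by
  rw [diagProj, Matrix.ofLp_toEuclideanCLM, Matrix.mulVec_diagonal]
  split_ifs <;> simp

lemma diagProj_eq_self {n : ℕ} {J : Finset (Fin n)} {x : L2n n} (hx : ∀ i ∉ J, x i = 0) :
    diagProj J x = x := by
  ext i
  rw [diagProj_apply]
  split_ifs with h
  · rfl
  · exact (hx i h).symm

lemma isSelfAdjoint_diagProj {n : ℕ} (J : Finset (Fin n)) : IsSelfAdjoint (diagProj J) := by
  rw [diagProj, IsSelfAdjoint, ← map_star, Matrix.star_eq_conjTranspose,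
    Matrix.diagonal_conjTranspose]
  congr 2
  ext i
  simp only [Pi.star_apply]
  split_ifs <;> simp

lemma norm_diagProj_apply_le {n : ℕ} (J : Finset (Fin n)) (x : L2n n) : ‖diagProj J x‖ ≤ ‖x‖ := by
  rw [EuclideanSpace.norm_eq, EuclideanSpace.norm_eq]
  gcongr with i
  rw [diagProj_apply]
  split_ifs <;> simp

lemma inner_diagProj_left {n : ℕ} (J : Finset (Fin n)) (x y : L2n n) :
    ⟪diagProj J x, y⟫_ℂ = ⟪x, diagProj J y⟫_ℂ := by
  rw [← ContinuousLinearMap.adjoint_inner_right, ← ContinuousLinearMap.star_eq_adjoint,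
    isSelfAdjoint_diagProj]

/-- The numerical range bounds the norm of a compressed projection. -/
lemma norm_diagProj_mul_mul_le {n : ℕ} {P : L2n n →L[ℂ] L2n n} (hP : IsStarProjection P)
    {J : Finset (Fin n)} {c : ℝ} (hc : 0 ≤ c)
    (h : ∀ x : L2n n, (∀ i ∉ J, x i = 0) → (⟪x, P x⟫_ℂ).re ≤ c * ‖x‖ ^ 2) :
    ‖diagProj J * P * diagProj J‖ ≤ c := by
  set Q := diagProj J with hQ
  -- For a projection the quadratic form at `Q x` is `‖P Q x‖ ^ 2`; the C⋆-identity for `QPQ =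
  -- (PQ)⋆(PQ)` then returns `c`.
  have h1 : ‖P * Q‖ ≤ √c := by
    refine ContinuousLinearMap.opNorm_le_bound _ (Real.sqrt_nonneg c) fun x => ?_
    have h2 := h (Q x) fun i hi => by rw [hQ, diagProj_apply, if_neg hi]
    have h3 : ⟪Q x, P (Q x)⟫_ℂ = ⟪P (Q x), P (Q x)⟫_ℂ := by
      rw [← ContinuousLinearMap.adjoint_inner_right P, ← ContinuousLinearMap.star_eq_adjoint,
        hP.isSelfAdjoint.star_eq, ← mul_apply_eq_comp P P, hP.isIdempotentElem.eq]
    rw [h3, inner_self_eq_norm_sq_to_K] at h2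
    have h4 : ‖P (Q x)‖ ^ 2 ≤ c * ‖x‖ ^ 2 := by
      have h5 : ‖P (Q x)‖ ^ 2 ≤ c * ‖Q x‖ ^ 2 := by
        refine le_trans (le_of_eq ?_) h2
        norm_cast
      refine h5.trans ?_
      gcongr
      exact norm_diagProj_apply_le J x
    rw [mul_apply_eq_comp]
    refine (sq_le_sq₀ (norm_nonneg _) (by positivity)).1 ?_
    rw [mul_pow, Real.sq_sqrt hc]
    exact h4
  have h2 : Q * P * Q = star (P * Q) * (P * Q) := by
    rw [star_mul, hP.isSelfAdjoint.star_eq, (isSelfAdjoint_diagProj J).star_eq, ← mul_assoc,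
      mul_assoc _ P P, hP.isIdempotentElem.eq]
  rw [h2]
  calc _ = ‖P * Q‖ * ‖P * Q‖ := ContinuousLinearMap.norm_adjoint_comp_self (P * Q)
    _ ≤ √c * √c := by gcongr
    _ = c := Real.mul_self_sqrt hc

/-- A norm bound of a compression bounds the quadratic form. -/
lemma re_inner_le_of_norm_diagProj_mul_mul_le {n : ℕ} {P : L2n n →L[ℂ] L2n n}
    {J : Finset (Fin n)} {c : ℝ} (h : ‖diagProj J * P * diagProj J‖ ≤ c) {x : L2n n}
    (hx : ∀ i ∉ J, x i = 0) : (⟪x, P x⟫_ℂ).re ≤ c * ‖x‖ ^ 2 := by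
  have h1 : ⟪x, P x⟫_ℂ = ⟪x, (diagProj J * P * diagProj J) x⟫_ℂ := by
    rw [mul_apply_eq_comp, mul_apply_eq_comp, ← inner_diagProj_left, diagProj_eq_self hx]
  rw [h1]
  calc _ ≤ ‖⟪x, (diagProj J * P * diagProj J) x⟫_ℂ‖ := Complex.re_le_norm _
    _ ≤ ‖x‖ * ‖(diagProj J * P * diagProj J) x‖ := norm_inner_le_norm _ _
    _ ≤ ‖x‖ * (c * ‖x‖) := by
      gcongr
      exact ContinuousLinearMap.le_of_opNorm_le _ h x
    _ = c * ‖x‖ ^ 2 := by ring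

/-! ### Isometries of `ℓ₂ⁿ` into `ℓ₂` -/

/-- The isometry of `ℓ₂ⁿ` into `ℓ₂` which maps `e_i` to `e_{f i}`. -/
def embed {n : ℕ} (f : Fin n → ℕ) (hf : Function.Injective f) : L2n n →ₗᵢ[ℂ] L2 :=
  LinearMap.isometryOfInner
    { toFun := fun x => ∑ i, x i • e (f i)
      map_add' := fun x y => by simp [add_smul, Finset.sum_add_distrib]
      map_smul' := fun c x => by simp [Finset.smul_sum, smul_smul] }
    fun x y => by
      have := (orthonormal_e.comp f hf).inner_sum (fun i => x i) (fun i => y i) Finset.univ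
      simp only [Function.comp] at this
      simp only [LinearMap.coe_mk, AddHom.coe_mk, this, PiLp.inner_apply, RCLike.inner_apply]
      exact Finset.sum_congr rfl fun i _ => mul_comm _ _

lemma embed_apply {n : ℕ} (f : Fin n → ℕ) (hf : Function.Injective f) (x : L2n n) :
    embed f hf x = ∑ i, x i • e (f i) := rfl

lemma embed_en {n : ℕ} (f : Fin n → ℕ) (hf : Function.Injective f) (i : Fin n) :
    embed f hf (en i) = e (f i) := by
  rw [embed_apply, Finset.sum_eq_single i] <;> simp +contextual

lemma embed_coord_of_notMem {n : ℕ} (f : Fin n → ℕ) (hf : Function.Injective f) (x : L2n n) {m : ℕ}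
    (hm : ∀ i, x i ≠ 0 → f i ≠ m) : embed f hf x m = 0 := by
  rw [← inner_e_left, embed_apply, inner_sum]
  refine Finset.sum_eq_zero fun i _ => ?_
  by_cases hx : x i = 0
  · simp [hx]
  · rw [inner_smul_right, orthonormal_e.2 (hm i hx).symm, mul_zero]

lemma inner_embed_embed_of_disjoint {n m : ℕ} (f : Fin n → ℕ) (hf : Function.Injective f)
    (g : Fin m → ℕ) (hg : Function.Injective g) (h : ∀ i j, f i ≠ g j) (x : L2n n) (y : L2n m) :
    ⟪embed f hf x, embed g hg y⟫_ℂ = 0 := by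
  rw [embed_apply, embed_apply, sum_inner]
  refine Finset.sum_eq_zero fun i _ => ?_
  rw [inner_sum]
  refine Finset.sum_eq_zero fun j _ => ?_
  rw [inner_smul_left, inner_smul_right, orthonormal_e.2 (h i j), mul_zero, mul_zero]

/-! ### Direct sums of projections -/

lemma pair_injective (r n : ℕ) : Function.Injective fun i : Fin n => Nat.pair r i := fun i j h => by
  have := (Nat.pair_eq_pair.1 h).2
  exact Fin.ext this

/-- The direct sum of finite-dimensional projections, realized on `ℓ₂`. -/
lemma exists_directSum {n : ℕ → ℕ} (P : ∀ r, L2n (n r) →L[ℂ] L2n (n r))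
    (hP : ∀ r, IsStarProjection (P r)) :
    ∃ T : L2 →L[ℂ] L2,
      (∀ r x, T (embed _ (pair_injective r (n r)) x) = embed _ (pair_injective r (n r)) (P r x)) ∧
      ∀ r i, n r ≤ i → T (e (Nat.pair r i)) = 0 := by
  let J := fun r => embed _ (pair_injective r (n r))
  -- The ranges of the `P r`, placed in disjoint blocks of coordinates. The direct sum is the
  -- orthogonal projection onto their closed span, so its boundedness needs no argument.
  let M : ℕ → Submodule ℂ L2 := fun r => (LinearMap.range (P r).toLinearMap).map (J r).toLinearMap
  have hM : ∀ r v, J r (P r v) ∈ M r := fun r v => ⟨P r v, ⟨v, rfl⟩, rfl⟩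
  have hmem : ∀ r v, J r (P r v) ∈ (⨆ r, M r).topologicalClosure := fun r v =>
    Submodule.le_topologicalClosure _ (Submodule.mem_iSup_of_mem r (hM r v))
  have horth : ∀ u : L2, (∀ s v, ⟪J s (P s v), u⟫_ℂ = 0) → u ∈ (⨆ r, M r).topologicalClosureᗮ := by
    intro u hu
    rw [Submodule.orthogonal_closure, ← Submodule.iInf_orthogonal, Submodule.mem_iInf]
    intro s
    rw [Submodule.mem_orthogonal]
    rintro _ ⟨_, ⟨v, rfl⟩, rfl⟩
    exact hu s v
  refine ⟨(⨆ r, M r).topologicalClosure.starProjection, fun r x => ?_, fun r i hi => ?_⟩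
  · refine Submodule.eq_starProjection_of_mem_orthogonal (hmem r x) (horth _ fun s v => ?_)
    rw [← map_sub]
    by_cases hsr : s = r
    · subst hsr
      rw [LinearIsometry.inner_map_map, ← ContinuousLinearMap.adjoint_inner_right,
        ← ContinuousLinearMap.star_eq_adjoint, (hP s).isSelfAdjoint.star_eq, map_sub,
        ← mul_apply_eq_comp (P s) (P s), (hP s).isIdempotentElem.eq, sub_self, inner_zero_right]
    · exact inner_embed_embed_of_disjoint _ _ _ _
        (fun i j h => hsr (Nat.pair_eq_pair.1 h).1) _ _
  · refine Submodule.eq_starProjection_of_mem_orthogonal (Submodule.zero_mem _) ?_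
    refine horth _ fun s v => ?_
    rw [sub_zero, ← inner_conj_symm, inner_e_left, embed_coord_of_notMem, map_zero]
    rintro ⟨j, hj⟩ - h
    obtain ⟨rfl, rfl⟩ := Nat.pair_eq_pair.1 h
    exact absurd hj (not_lt.2 hi)

lemma norm_inner_en_le_diagMax {n : ℕ} (T : L2n n →L[ℂ] L2n n) (i : Fin n) :
    ‖⟪en i, T (en i)⟫_ℂ‖ ≤ diagMax T :=
  le_ciSup (f := fun i => ‖⟪en i, T (en i)⟫_ℂ‖) (Set.finite_range _).bddAbove i

/-- A diagonal argument: one counterexample for each number of colors is put into a single operator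
on `ℓ₂`, whose finite coloring uses some number `k` of colors and so paves the block that was to
refute `k`. -/
theorem KS.equalNormPavingConjecture (hKS : KS) : EqualNormPavingConjecture := by
  by_contra hcon
  have hfail : ∀ r : ℕ, ∃ (n : ℕ) (P : L2n n →L[ℂ] L2n n), IsStarProjection P ∧
      diagMax P ≤ 1 / 4 ∧ ¬ ∃ A : Fin r → Finset (Fin n), IsPaving A ∧
        ∀ j, ‖diagProj (A j) * P * diagProj (A j)‖ ≤ 1 - 1 / 2 := by
    intro r
    by_contra! h
    -- The constants satisfy `√δ = ε` and leave the gap `δ < 1 - ε` that the coloring needs.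
    refine hcon ⟨1 / 4, 1 / 2, r, by norm_num, ?_, by norm_num, fun n P hP hd _ => h n P hP hd⟩
    rw [show (1 / 4 : ℝ) = (1 / 2) ^ 2 by norm_num, Real.sqrt_sq (by norm_num)]
  choose n P hP hd hA using hfail
  obtain ⟨T, hT, hT0⟩ := exists_directSum P hP
  have hdiag : ∀ m, (⟪e m, T (e m)⟫_ℂ).re ≤ 1 / 4 := by
    intro m
    obtain ⟨r, i, rfl⟩ : ∃ r i, m = Nat.pair r i := ⟨_, _, (Nat.pair_unpair m).symm⟩
    by_cases hi : i < n r
    · have h1 : e (Nat.pair r i) = embed _ (pair_injective r (n r)) (en ⟨i, hi⟩) :=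
        (embed_en _ (pair_injective r (n r)) ⟨i, hi⟩).symm
      rw [h1, hT, LinearIsometry.inner_map_map]
      exact (Complex.re_le_norm _).trans ((norm_inner_en_le_diagMax _ _).trans (hd r))
    · rw [hT0 r i (not_lt.1 hi), inner_zero_right]
      norm_num
  obtain ⟨k, g, hg⟩ := hKS.exists_coloring T (show (1 / 4 : ℝ) < 1 / 2 by norm_num) hdiag
  refine hA k ⟨fun j => Finset.univ.filter fun i => g (Nat.pair k i) = j, ⟨?_, ?_⟩, fun j => ?_⟩
  · intro j l hjl
    rw [Finset.disjoint_left]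
    intro i hi hi'
    simp only [Finset.mem_filter, Finset.mem_univ, true_and] at hi hi'
    exact hjl (hi.symm.trans hi')
  · intro i
    exact ⟨g (Nat.pair k i), by simp⟩
  · refine norm_diagProj_mul_mul_le (hP k) (by norm_num) fun x hx => ?_
    have h1 := hg j (embed _ (pair_injective k (n k)) x) fun m hm =>
      embed_coord_of_notMem _ _ _ fun i hi him => hi (hx i fun hij => hm ?_)
    · rw [hT, LinearIsometry.inner_map_map, LinearIsometry.norm_map] at h1
      linarith
    · simp only [Finset.mem_filter, Finset.mem_univ, true_and] at hij
      rw [← hij, ← him]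

/-! ### Projections with constant diagonal -/

lemma isPositive_of_re_inner_nonneg {n : ℕ} {T : L2n n →L[ℂ] L2n n} (hT : IsSelfAdjoint T)
    (h : ∀ x, 0 ≤ (⟪x, T x⟫_ℂ).re) : T.IsPositive := by
  rw [ContinuousLinearMap.isPositive_def']
  refine ⟨hT, fun x => ?_⟩
  have h1 := h x
  rw [← inner_conj_symm, Complex.conj_re] at h1
  exact h1

lemma re_inner_self {n : ℕ} (x : L2n n) : (⟪x, x⟫_ℂ).re = ‖x‖ ^ 2 :=
  inner_self_eq_norm_sq (𝕜 := ℂ) x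

lemma inner_en_left {n : ℕ} (x : L2n n) (i : Fin n) : ⟪en i, x⟫_ℂ = x i := by
  rw [EuclideanSpace.inner_single_left]
  simp

lemma eq_sum_smul_en {n : ℕ} (x : L2n n) : x = ∑ j, x j • en j := by
  ext i
  simp [Pi.single_apply]

/-- The Gram matrix of a Parseval frame is a projection. -/
lemma exists_isStarProjection_of_parseval {n N : ℕ} (v : Fin N → L2n n)
    (hv : ∀ h, ∑ a, ⟪v a, h⟫_ℂ • v a = h) :
    ∃ P : L2n N →L[ℂ] L2n N, IsStarProjection P ∧
      ∀ x y : L2n N, ⟪x, P y⟫_ℂ = ⟪∑ a, x a • v a, ∑ a, y a • v a⟫_ℂ := by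
  let W : L2n N →L[ℂ] L2n n := LinearMap.toContinuousLinearMap
    { toFun := fun x => ∑ a, x a • v a
      map_add' := fun x y => by simp [add_smul, Finset.sum_add_distrib]
      map_smul' := fun c x => by simp [Finset.smul_sum, smul_smul] }
  have hW : ∀ x, W x = ∑ a, x a • v a := fun x => rfl
  have hWen : ∀ a, W (en a) = v a := fun a => by
    rw [hW, Finset.sum_eq_single a] <;> simp +contextual
  have hadj : ∀ h a, ContinuousLinearMap.adjoint W h a = ⟪v a, h⟫_ℂ := by
    intro h a
    rw [← hWen a, ← ContinuousLinearMap.adjoint_inner_right, EuclideanSpace.inner_single_left]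
    simp
  have hWW : ∀ h, W (ContinuousLinearMap.adjoint W h) = h := by
    intro h
    rw [hW]
    simp only [hadj]
    exact hv h
  -- The Parseval identity says `W W⋆ = 1` for the synthesis map `W`, so `W⋆ W` is idempotent.
  refine ⟨(ContinuousLinearMap.adjoint W).comp W, ⟨?_, ?_⟩, fun x y => ?_⟩
  · ext x : 1
    simp only [mul_apply_eq_comp, ContinuousLinearMap.comp_apply, hWW]
  · exact (ContinuousLinearMap.isPositive_adjoint_comp_self W).isSelfAdjoint
  · rw [ContinuousLinearMap.comp_apply, ContinuousLinearMap.adjoint_inner_right, hW, hW]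

/-- The vectors `√T e_j` together with `p` copies of `√(1 - T) e_j / √p`. -/
def dilationVector {n p : ℕ} (A B : L2n n →L[ℂ] L2n n) (j : Fin n × Fin (p + 1)) : L2n n :=
  Fin.cases (motive := fun _ => L2n n) (A (en j.1)) (fun _ => ((√p)⁻¹ : ℂ) • B (en j.1)) j.2

/-- The frame operator of the columns of `A` is `A A⋆`. For `√T` and `√(1 - T)` these operators add
up to the identity, which makes the dilation vectors a Parseval frame. -/
lemma sum_inner_smul_apply_en {n : ℕ} {A : L2n n →L[ℂ] L2n n} (hA : IsSelfAdjoint A) (h : L2n n) :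
    ∑ j, ⟪A (en j), h⟫_ℂ • A (en j) = A (A h) := by
  have h1 : ∀ j, ⟪A (en j), h⟫_ℂ = A h j := fun j => by
    rw [← ContinuousLinearMap.adjoint_inner_right, ← ContinuousLinearMap.star_eq_adjoint, hA.star_eq,
      inner_en_left]
  simp only [h1]
  conv_rhs => rw [eq_sum_smul_en (A h), map_sum]
  simp only [map_smul]

lemma inner_apply_apply_of_isSelfAdjoint {n : ℕ} {A : L2n n →L[ℂ] L2n n} (hA : IsSelfAdjoint A)
    (x y : L2n n) : ⟪A x, A y⟫_ℂ = ⟪x, (A * A) y⟫_ℂ := by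
  rw [← ContinuousLinearMap.adjoint_inner_right, ← ContinuousLinearMap.star_eq_adjoint, hA.star_eq,
    mul_apply_eq_comp]

/-- A contraction with constant diagonal `1 / (p + 1)` is a corner of a projection with the same
constant diagonal. -/
lemma exists_dilation {n p : ℕ} (hp : 0 < p) {T : L2n n →L[ℂ] L2n n} (hT : T.IsPositive)
    (hT1 : ∀ x, (⟪x, T x⟫_ℂ).re ≤ ‖x‖ ^ 2)
    (hd : ∀ i, ⟪en i, T (en i)⟫_ℂ = ((1 / (p + 1) : ℝ) : ℂ)) :
    ∃ P : L2n (n * (p + 1)) →L[ℂ] L2n (n * (p + 1)), IsStarProjection P ∧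
      (∀ a, ⟪en a, P (en a)⟫_ℂ = ((1 / (p + 1) : ℝ) : ℂ)) ∧
      ∀ (x : L2n n) (X : L2n (n * (p + 1))),
        (∀ i, X (finProdFinEquiv (i, 0)) = x i) →
        (∀ i k, X (finProdFinEquiv (i, Fin.succ k)) = 0) → ⟪X, P X⟫_ℂ = ⟪x, T x⟫_ℂ := by
  have h0 : 0 ≤ T := (ContinuousLinearMap.nonneg_iff_isPositive _).2 hT
  have h1 : 0 ≤ 1 - T := by
    refine (ContinuousLinearMap.nonneg_iff_isPositive _).2 (isPositive_of_re_inner_nonneg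
      ((IsSelfAdjoint.one _).sub hT.isSelfAdjoint) fun x => ?_)
    rw [_root_.sub_apply, one_apply_eq_self, inner_sub_right, Complex.sub_re,
      re_inner_self]
    exact sub_nonneg.2 (hT1 x)
  set A := CFC.sqrt T
  set B := CFC.sqrt (1 - T)
  have hA : IsSelfAdjoint A := (CFC.sqrt_nonneg T).isSelfAdjoint
  have hB : IsSelfAdjoint B := (CFC.sqrt_nonneg (1 - T)).isSelfAdjoint
  have hAA : A * A = T := CFC.sqrt_mul_sqrt_self T h0
  have hBB : B * B = 1 - T := CFC.sqrt_mul_sqrt_self (1 - T) h1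
  have hp' : (p : ℂ) ≠ 0 := by exact_mod_cast hp.ne'
  have hpp : ((√p : ℝ) : ℂ)⁻¹ * ((√p : ℝ) : ℂ)⁻¹ = (p : ℂ)⁻¹ := by
    rw [← mul_inv, ← Complex.ofReal_mul, Real.mul_self_sqrt (Nat.cast_nonneg p)]
    simp
  let w : Fin n × Fin (p + 1) → L2n n := dilationVector A B
  have hw0 : ∀ i, w (i, 0) = A (en i) := fun i => rfl
  have hws : ∀ i k, w (i, Fin.succ k) = ((√p : ℝ) : ℂ)⁻¹ • B (en i) := fun i k => rfl
  let v : Fin (n * (p + 1)) → L2n n := fun a => w (finProdFinEquiv.symm a)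
  have hv : ∀ b, v (finProdFinEquiv b) = w b := fun b => by
    simp only [v, Equiv.symm_apply_apply]
  obtain ⟨P, hP, hPv⟩ := exists_isStarProjection_of_parseval v (by
    intro h
    rw [← finProdFinEquiv.sum_comp, Fintype.sum_prod_type]
    simp only [hv, Fin.sum_univ_succ, hw0, hws, Finset.sum_add_distrib, Finset.sum_const,
      Finset.card_univ, Fintype.card_fin, inner_smul_left, smul_smul, map_inv₀, Complex.conj_ofReal]
    have h2 : ∀ j, ((((√p : ℝ) : ℂ)⁻¹ * ⟪B (en j), h⟫_ℂ * ((√p : ℝ) : ℂ)⁻¹) • B (en j)) =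
        (p : ℂ)⁻¹ • (⟪B (en j), h⟫_ℂ • B (en j)) := fun j => by
      rw [smul_smul, ← hpp]
      ring_nf
    simp only [h2]
    rw [← Finset.smul_sum, ← Finset.smul_sum, sum_inner_smul_apply_en hA,
      sum_inner_smul_apply_en hB, ← Nat.cast_smul_eq_nsmul ℂ, smul_smul, mul_inv_cancel₀ hp',
      one_smul, ← mul_apply_eq_comp, ← mul_apply_eq_comp, hAA, hBB]
    simp)
  refine ⟨P, hP, fun a => ?_, fun x X hX0 hXs => ?_⟩
  · have hsum : ∑ b, (en a : L2n (n * (p + 1))) b • v b = v a := by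
      rw [Finset.sum_eq_single a] <;> simp +contextual
    rw [hPv, hsum]
    obtain ⟨⟨i, k⟩, rfl⟩ := finProdFinEquiv.surjective a
    rw [hv]
    refine Fin.cases ?_ (fun k => ?_) k
    · rw [hw0, inner_apply_apply_of_isSelfAdjoint hA, hAA, hd]
    -- The number `p` of copies is chosen for this: `(1 - 1/(p+1)) / p = 1/(p+1)`.
    · rw [hws, inner_smul_left, inner_smul_right, inner_apply_apply_of_isSelfAdjoint hB, hBB,
        _root_.sub_apply, inner_sub_right, hd, one_apply_eq_self, map_inv₀, Complex.conj_ofReal,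
        ← mul_assoc, hpp]
      have : (p : ℂ) + 1 ≠ 0 := by exact_mod_cast p.succ_ne_zero
      simp only [EuclideanSpace.inner_single_left]
      simp
      field_simp
      ring
  · have hsum : ∑ b, X b • v b = A x := by
      rw [← finProdFinEquiv.sum_comp, Fintype.sum_prod_type]
      simp only [Fin.sum_univ_succ, hX0, hXs, hv, hw0, zero_smul, Finset.sum_const_zero, add_zero]
      conv_rhs => rw [eq_sum_smul_en x, map_sum]
      simp only [map_smul]
    rw [hPv, hsum, inner_apply_apply_of_isSelfAdjoint hA, hAA]

/-- The paving hypothesis for equal norm projections, with constants `δ`, `ε`, `r`. -/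
def EqualNormPaves (δ ε : ℝ) (r : ℕ) : Prop :=
  ∀ (n : ℕ) (P : L2n n →L[ℂ] L2n n), IsStarProjection P →
    diagMax P ≤ δ → (∀ i j : Fin n, ‖P (en i)‖ = ‖P (en j)‖) →
      ∃ A : Fin r → Finset (Fin n), IsPaving A ∧
        ∀ j, ‖diagProj (A j) * P * diagProj (A j)‖ ≤ 1 - ε

/-- The dilation is an admissible projection, since `‖P e_a‖ ^ 2 = ⟨P e_a, e_a⟩` is constant.
Restricting its paving to the slots `(i, 0)` colors the corner `T`. -/
lemma EqualNormPaves.exists_coloring_of_const_diag {δ ε : ℝ} {r : ℕ} (h : EqualNormPaves δ ε r)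
    {n p : ℕ} (hp : 0 < p) (hpδ : 1 / (p + 1 : ℝ) ≤ δ) {T : L2n n →L[ℂ] L2n n} (hT : T.IsPositive)
    (hT1 : ∀ x, (⟪x, T x⟫_ℂ).re ≤ ‖x‖ ^ 2)
    (hd : ∀ i, ⟪en i, T (en i)⟫_ℂ = ((1 / (p + 1) : ℝ) : ℂ)) :
    ∃ g : Fin n → Fin r, ∀ j, ∀ x : L2n n, (∀ i, g i ≠ j → x i = 0) →
      (⟪x, T x⟫_ℂ).re ≤ (1 - ε) * ‖x‖ ^ 2 := by
  obtain ⟨P, hP, hPd, hPX⟩ := exists_dilation hp hT hT1 hd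
  have hp0 : (0 : ℝ) ≤ 1 / (p + 1) := by positivity
  have hnorm : ∀ a, ‖P (en a)‖ ^ 2 = 1 / (p + 1) := by
    intro a
    rw [← re_inner_self, inner_apply_apply_of_isSelfAdjoint hP.isSelfAdjoint,
      hP.isIdempotentElem.eq, hPd, Complex.ofReal_re]
  obtain ⟨A, ⟨-, hA⟩, hAn⟩ := h _ P hP
    (Real.iSup_le (fun a => by
      rw [hPd, Complex.norm_real, Real.norm_of_nonneg hp0]
      exact hpδ) (hp0.trans hpδ))
    (fun a b => by
      rw [← sq_eq_sq₀ (norm_nonneg _) (norm_nonneg _), hnorm, hnorm])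
  choose g hg using fun i => hA (finProdFinEquiv (i, 0))
  refine ⟨g, fun j x hx => ?_⟩
  let X : L2n (n * (p + 1)) := WithLp.toLp 2 fun a =>
    Fin.cases (motive := fun _ => ℂ) (x (finProdFinEquiv.symm a).1) (fun _ => 0)
      (finProdFinEquiv.symm a).2
  have hX0 : ∀ i, X (finProdFinEquiv (i, 0)) = x i := fun i => by simp [X]
  have hXs : ∀ i k, X (finProdFinEquiv (i, Fin.succ k)) = 0 := fun i k => by simp [X]
  have hXn : ‖X‖ ^ 2 = ‖x‖ ^ 2 := by
    rw [EuclideanSpace.norm_sq_eq, EuclideanSpace.norm_sq_eq, ← finProdFinEquiv.sum_comp,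
      Fintype.sum_prod_type]
    simp [Fin.sum_univ_succ, hX0, hXs]
  rw [← hPX x X hX0 hXs, ← hXn]
  refine re_inner_le_of_norm_diagProj_mul_mul_le (hAn j) fun a ha => ?_
  obtain ⟨⟨i, k⟩, rfl⟩ := finProdFinEquiv.surjective a
  revert ha
  refine Fin.cases (fun ha => ?_) (fun k _ => hXs i k) k
  rw [hX0]
  exact hx i fun hij => ha (hij ▸ hg i)

/-- Contractions with small diagonal have pavings. -/
lemma EqualNormPaves.exists_coloring {δ ε : ℝ} {r : ℕ} (h : EqualNormPaves δ ε r)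
    {n p : ℕ} (hp : 0 < p) (hpδ : 1 / (p + 1 : ℝ) ≤ δ) {T : L2n n →L[ℂ] L2n n} (hT : T.IsPositive)
    (hT1 : ∀ x, (⟪x, T x⟫_ℂ).re ≤ ‖x‖ ^ 2) (hd : ∀ i, (⟪en i, T (en i)⟫_ℂ).re ≤ 1 / p) :
    ∃ g : Fin n → Fin r, ∀ j, ∀ x : L2n n, (∀ i, g i ≠ j → x i = 0) →
      (⟪x, T x⟫_ℂ).re ≤ (p + 1) / p * (1 - ε) * ‖x‖ ^ 2 := by
  have hp' : (0 : ℝ) < p := by exact_mod_cast hp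
  -- What is missing from the diagonal of `T` to the constant `1 / p`. Adding it raises the norm to
  -- at most `(p + 1) / p`, and the factor `c` below restores a contraction, now with diagonal `1 /
  -- (p + 1)`.
  let d : Fin n → ℝ := fun i => 1 / p - (⟪en i, T (en i)⟫_ℂ).re
  have hd0 : ∀ i, 0 ≤ d i := fun i => sub_nonneg.2 (hd i)
  have hTpos : ∀ x, 0 ≤ ⟪x, T x⟫_ℂ := fun x => hT.inner_nonneg_right x
  have hd1 : ∀ i, d i ≤ 1 / p := fun i => sub_le_self _ (Complex.nonneg_iff.1 (hTpos _)).1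
  let D : L2n n →L[ℂ] L2n n := Matrix.toEuclideanCLM (𝕜 := ℂ) (Matrix.diagonal fun i => (d i : ℂ))
  have hDapp : ∀ x i, D x i = d i * x i := fun x i => by
    rw [Matrix.ofLp_toEuclideanCLM, Matrix.mulVec_diagonal]
  have hD : ∀ x, ⟪x, D x⟫_ℂ = ((∑ i, d i * ‖x i‖ ^ 2 : ℝ) : ℂ) := by
    intro x
    rw [PiLp.inner_apply]
    push_cast
    refine Finset.sum_congr rfl fun i _ => ?_
    rw [hDapp, RCLike.inner_apply, mul_assoc, RCLike.mul_conj]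
    rfl
  have hDself : IsSelfAdjoint D := by
    rw [IsSelfAdjoint, ← map_star, Matrix.star_eq_conjTranspose, Matrix.diagonal_conjTranspose]
    congr 2
    ext i
    simp
  have hDpos : ∀ x, 0 ≤ (⟪x, D x⟫_ℂ).re := fun x => by
    rw [hD, Complex.ofReal_re]
    exact Finset.sum_nonneg fun i _ => mul_nonneg (hd0 i) (sq_nonneg _)
  have hDle : ∀ x, (⟪x, D x⟫_ℂ).re ≤ 1 / p * ‖x‖ ^ 2 := fun x => by
    rw [hD, Complex.ofReal_re, EuclideanSpace.norm_sq_eq, Finset.mul_sum]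
    gcongr with i
    exact hd1 i
  let c : ℝ := p / (p + 1)
  have hc : 0 < c := by positivity
  let T' : L2n n →L[ℂ] L2n n := (c : ℂ) • (T + D)
  have hT' : ∀ x, ⟪x, T' x⟫_ℂ = c * (⟪x, T x⟫_ℂ + ⟪x, D x⟫_ℂ) := fun x => by
    rw [_root_.smul_apply, _root_.add_apply, inner_smul_right, inner_add_right]
  have hT're : ∀ x, (⟪x, T' x⟫_ℂ).re = c * ((⟪x, T x⟫_ℂ).re + (⟪x, D x⟫_ℂ).re) := fun x => by
    rw [hT', Complex.re_ofReal_mul, Complex.add_re]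
  obtain ⟨g, hg⟩ := h.exists_coloring_of_const_diag (T := T') hp hpδ
    (isPositive_of_re_inner_nonneg
      (IsSelfAdjoint.smul (by simp [IsSelfAdjoint]) (hT.isSelfAdjoint.add hDself)) fun x => by
        rw [hT're]
        exact mul_nonneg hc.le (add_nonneg (Complex.nonneg_iff.1 (hTpos x)).1 (hDpos x)))
    (fun x => by
      rw [hT're]
      calc _ ≤ c * (‖x‖ ^ 2 + 1 / p * ‖x‖ ^ 2) := by
            gcongr
            exacts [hT1 x, hDle x]
        _ = ‖x‖ ^ 2 := by simp only [c]; field_simp)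
    (fun i => by
      have h1 : ⟪en i, T (en i)⟫_ℂ = (((⟪en i, T (en i)⟫_ℂ).re : ℝ) : ℂ) :=
        Complex.ext rfl (by simpa using (Complex.nonneg_iff.1 (hTpos (en i))).2.symm)
      have h2 : ∑ j, d j * ‖(en i : L2n n) j‖ ^ 2 = d i := by
        rw [Finset.sum_eq_single i] <;> simp +contextual
      rw [hT', hD, h2, h1, ← Complex.ofReal_add, ← Complex.ofReal_mul]
      simp only [d, c]
      congr 1
      field_simp
      ring)
  refine ⟨g, fun j x hx => ?_⟩
  have h1 := hg j x hx
  rw [hT're] at h1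
  have h2 := hDpos x
  have h3 : (⟪x, T x⟫_ℂ).re + (⟪x, D x⟫_ℂ).re =
      (p + 1) / p * (c * ((⟪x, T x⟫_ℂ).re + (⟪x, D x⟫_ℂ).re)) := by
    simp only [c]
    field_simp
  calc (⟪x, T x⟫_ℂ).re ≤ (⟪x, T x⟫_ℂ).re + (⟪x, D x⟫_ℂ).re := by linarith
    _ ≤ (p + 1) / p * ((1 - ε) * ‖x‖ ^ 2) := by
      rw [h3]
      gcongr
    _ = _ := by ring

/-! ### Colorings with few monochromatic neighbors -/

/-- Every symmetric weight on a complete graph has a coloring with `R` colors such that the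
monochromatic weight at each vertex is at most the fraction `1 / R` of its total weight. -/
lemma exists_coloring_weight_le {V : Type*} [Fintype V] [DecidableEq V] {R : ℕ} (hR : 0 < R)
    (s : V → V → ℝ) (hs : ∀ i j, s i j = s j i) (hs0 : ∀ i, s i i = 0) :
    ∃ f : V → Fin R, ∀ j, R * ∑ i, (if f i = f j then s i j else 0) ≤ ∑ i, s i j := by
  have : NeZero R := ⟨hR.ne'⟩
  -- Minimize the total monochromatic weight. Recoloring `j` alone cannot lower it, so the weight
  -- from `j` to its own class is at most that to any class `k`; summing over the `R` classes gives
  -- the claim.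
  obtain ⟨f, hf⟩ := Finite.exists_min fun f : V → Fin R =>
    ∑ i, ∑ l, if f i = f l then s i l else 0
  refine ⟨f, fun j => ?_⟩
  have hsplit : ∀ f : V → Fin R, ∑ i, ∑ l, (if f i = f l then s i l else 0) =
      ∑ i ∈ Finset.univ.erase j, ∑ l ∈ Finset.univ.erase j, (if f i = f l then s i l else 0) +
        2 * ∑ i, (if f i = f j then s i j else 0) := by
    intro f
    have h1 : ∀ i, ∑ l, (if f i = f l then s i l else 0) =
        ∑ l ∈ Finset.univ.erase j, (if f i = f l then s i l else 0) +
          (if f i = f j then s i j else 0) := fun i =>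
      (Finset.sum_erase_add _ _ (Finset.mem_univ j)).symm
    rw [← Finset.sum_erase_add _ _ (Finset.mem_univ j)]
    have h2 : ∑ l, (if f j = f l then s j l else 0) = ∑ i, (if f i = f j then s i j else 0) :=
      Finset.sum_congr rfl fun i _ => by simp only [hs j i, @eq_comm _ (f j)]
    have h3 : ∑ i, (if f i = f j then s i j else 0) =
        ∑ i ∈ Finset.univ.erase j, (if f i = f j then s i j else 0) := by
      rw [← Finset.sum_erase_add _ _ (Finset.mem_univ j), hs0]
      simp
    rw [h2, Finset.sum_congr rfl fun i _ => h1 i, Finset.sum_add_distrib, ← h3]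
    ring
  have hk : ∀ k, ∑ i, (if f i = f j then s i j else 0) ≤ ∑ i, (if f i = k then s i j else 0) := by
    intro k
    have h1 := hf (Function.update f j k)
    simp only [hsplit] at h1
    have h2 : ∑ i ∈ Finset.univ.erase j, ∑ l ∈ Finset.univ.erase j,
        (if Function.update f j k i = Function.update f j k l then s i l else 0) =
        ∑ i ∈ Finset.univ.erase j, ∑ l ∈ Finset.univ.erase j, (if f i = f l then s i l else 0) :=
      Finset.sum_congr rfl fun i hi => Finset.sum_congr rfl fun l hl => by
        rw [Function.update_of_ne (Finset.ne_of_mem_erase hi),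
          Function.update_of_ne (Finset.ne_of_mem_erase hl)]
    have h3 : ∑ i, (if Function.update f j k i = Function.update f j k j then s i j else 0) =
        ∑ i, (if f i = k then s i j else 0) :=
      Finset.sum_congr rfl fun i _ => by
        by_cases hi : i = j
        · subst hi
          simp [hs0]
        · rw [Function.update_of_ne hi, Function.update_self]
    rw [h2, h3] at h1
    linarith
  calc R * ∑ i, (if f i = f j then s i j else 0)
      = ∑ _k : Fin R, ∑ i, (if f i = f j then s i j else 0) := by simp
    _ ≤ ∑ k : Fin R, ∑ i, (if f i = k then s i j else 0) := Finset.sum_le_sum fun k _ => hk k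
    _ = ∑ i, s i j := by
      rw [Finset.sum_comm]
      simp

lemma norm_apply_le_of_norm_le_one {n : ℕ} {S : L2n n →L[ℂ] L2n n} (hS1 : ‖S‖ ≤ 1) (x : L2n n) :
    ‖S x‖ ≤ ‖x‖ := by
  simpa using S.le_of_opNorm_le hS1 x

/-- A self-adjoint contraction with zero diagonal has a coloring with small columns on each
color class. -/
lemma exists_coloring_column {n p : ℕ} (hp : 0 < p) {S : L2n n →L[ℂ] L2n n}
    (hS : IsSelfAdjoint S) (hS1 : ‖S‖ ≤ 1) (hd : ∀ i, ⟪en i, S (en i)⟫_ℂ = 0) :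
    ∃ f : Fin n → Fin p, ∀ j, ∑ i, (if f i = f j then ‖S (en j) i‖ ^ 2 else 0) ≤ 1 / p := by
  have hp' : (0 : ℝ) < p := by exact_mod_cast hp
  -- The weights are squared moduli of matrix entries, symmetric because `S` is self-adjoint; the
  -- total at `j` is `‖S e_j‖ ^ 2 ≤ 1`.
  obtain ⟨f, hf⟩ := exists_coloring_weight_le hp (fun i j => ‖⟪en i, S (en j)⟫_ℂ‖ ^ 2)
    (fun i j => by
      rw [← ContinuousLinearMap.adjoint_inner_left, ← ContinuousLinearMap.star_eq_adjoint,
        hS.star_eq, norm_inner_symm])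
    (fun i => by simp only [hd, norm_zero, ne_eq, OfNat.ofNat_ne_zero, not_false_eq_true, zero_pow])
  refine ⟨f, fun j => ?_⟩
  have h1 := hf j
  simp only [inner_en_left] at h1
  rw [← EuclideanSpace.norm_sq_eq] at h1
  have h2 : ‖S (en j)‖ ^ 2 ≤ 1 := by
    refine pow_le_one₀ (norm_nonneg _) ((norm_apply_le_of_norm_le_one hS1 _).trans ?_)
    simp
  rw [le_div_iff₀ hp']
  linarith

/-- A contraction with small columns on `J` has a paving of `J`. -/
lemma EqualNormPaves.exists_coloring_of_column {δ ε : ℝ} {r : ℕ} (h : EqualNormPaves δ ε r)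
    {n p : ℕ} (hp : 0 < p) (hpδ : 1 / (p + 1 : ℝ) ≤ δ) {S : L2n n →L[ℂ] L2n n} (hS1 : ‖S‖ ≤ 1)
    (J : Finset (Fin n)) (hJ : ∀ j ∈ J, ‖diagProj J (S (en j))‖ ^ 2 ≤ 1 / p) :
    ∃ g : Fin n → Fin r, ∀ j, ∀ x y : L2n n, (∀ i ∉ J, x i = 0) → (∀ i, g i ≠ j → x i = 0) →
      (∀ i ∉ J, y i = 0) → ‖⟪y, S x⟫_ℂ‖ ≤ √((p + 1) / p * (1 - ε)) * ‖x‖ * ‖y‖ := by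
  obtain ⟨Z, hZ⟩ : ∃ Z : L2n n →L[ℂ] L2n n, ∀ x, Z x = diagProj J (S (diagProj J x)) :=
    ⟨diagProj J * S * diagProj J, fun x => rfl⟩
  have hZin : ∀ x, (⟪x, (ContinuousLinearMap.adjoint Z).comp Z x⟫_ℂ).re = ‖Z x‖ ^ 2 := by
    intro x
    rw [ContinuousLinearMap.comp_apply, ContinuousLinearMap.adjoint_inner_right, re_inner_self]
  -- `Z⋆Z` is a positive contraction with diagonal entries `‖Z e_j‖ ^ 2 ≤ 1 / p`. Paving it bounds
  -- `‖Z x‖ ^ 2`, whence the square root in the constant.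
  obtain ⟨g, hg⟩ := h.exists_coloring hp hpδ (ContinuousLinearMap.isPositive_adjoint_comp_self Z)
    (fun x => by
      rw [hZin, hZ]
      gcongr
      exact (norm_diagProj_apply_le _ _).trans
        ((norm_apply_le_of_norm_le_one hS1 _).trans (norm_diagProj_apply_le _ _)))
    (fun j => by
      rw [hZin, hZ]
      by_cases hj : j ∈ J
      · rw [diagProj_eq_self (x := en j) fun i hi => by
          have : i ≠ j := fun hij => hi (hij ▸ hj)
          simp [this]]
        exact hJ j hj
      · have h1 : diagProj J (en j) = 0 := by
          ext i
          rw [diagProj_apply]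
          by_cases hij : i = j
          · subst hij
            simp [hj]
          · simp [hij]
        rw [h1, map_zero, map_zero, norm_zero, zero_pow two_ne_zero]
        positivity)
  refine ⟨g, fun j x y hx hxj hy => ?_⟩
  have h1 : ⟪y, S x⟫_ℂ = ⟪y, Z x⟫_ℂ := by
    rw [hZ, diagProj_eq_self hx, ← inner_diagProj_left, diagProj_eq_self hy]
  have h2 : ‖Z x‖ ≤ √((p + 1) / p * (1 - ε)) * ‖x‖ := by
    have h3 := hg j x hxj
    rw [hZin] at h3
    rw [← Real.sqrt_sq (norm_nonneg (Z x)), ← Real.sqrt_sq (norm_nonneg x),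
      ← Real.sqrt_mul' _ (sq_nonneg _)]
    exact Real.sqrt_le_sqrt h3
  rw [h1]
  calc _ ≤ ‖y‖ * ‖Z x‖ := norm_inner_le_norm _ _
    _ ≤ ‖y‖ * (√((p + 1) / p * (1 - ε)) * ‖x‖) := by gcongr
    _ = _ := by ring

/-- Finite self-adjoint contractions with zero diagonal have pavings with uniform constants. -/
lemma EqualNormPaves.exists_coloring_of_isSelfAdjoint {δ ε : ℝ} {r : ℕ} (h : EqualNormPaves δ ε r)
    {n p : ℕ} (hp : 0 < p) (hpδ : 1 / (p + 1 : ℝ) ≤ δ) {S : L2n n →L[ℂ] L2n n}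
    (hS : IsSelfAdjoint S) (hS1 : ‖S‖ ≤ 1) (hd : ∀ i, ⟪en i, S (en i)⟫_ℂ = 0) :
    ∃ g : Fin n → Fin p × Fin r, ∀ j, ∀ x y : L2n n, (∀ i, g i ≠ j → x i = 0) →
      (∀ i, g i ≠ j → y i = 0) →
        ‖⟪y, S x⟫_ℂ‖ ≤ √((p + 1) / p * (1 - ε)) * ‖x‖ * ‖y‖ := by
  obtain ⟨f, hf⟩ := exists_coloring_column hp hS hS1 hd
  have hk : ∀ k, ∀ j ∈ Finset.univ.filter fun i => f i = k,
      ‖diagProj (Finset.univ.filter fun i => f i = k) (S (en j))‖ ^ 2 ≤ 1 / p := by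
    intro k j hj
    obtain rfl : f j = k := (Finset.mem_filter.1 hj).2
    rw [EuclideanSpace.norm_sq_eq]
    refine le_trans (le_of_eq (Finset.sum_congr rfl fun i _ => ?_)) (hf j)
    rw [diagProj_apply]
    simp only [Finset.mem_filter, Finset.mem_univ, true_and]
    split_ifs <;> simp
  choose g hg using fun k => h.exists_coloring_of_column hp hpδ hS1 _ (hk k)
  refine ⟨fun i => (f i, g (f i) i), fun ⟨k, l⟩ x y hx hy => hg k l x y ?_ ?_ ?_⟩
  · exact fun i hi => hx i fun h => hi (by simpa using congrArg Prod.fst h)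
  · intro i hi
    refine hx i fun h => ?_
    obtain ⟨rfl, h2⟩ := Prod.mk.inj h
    exact hi h2
  · exact fun i hi => hy i fun h => hi (by simpa using congrArg Prod.fst h)

/-! ### Pavings on `ℓ₂` -/

/-- The partial sums of the expansion of a vector. -/
def truncate (M : ℕ) (x : L2) : L2 := ∑ i ∈ Finset.range M, x i • e i

lemma tendsto_truncate (x : L2) : Tendsto (fun M => truncate M x) atTop (𝓝 x) :=
  (hasSum_e x).tendsto_sum_nat

lemma truncate_eq_embed {M n : ℕ} (hMn : M ≤ n) (x : L2) :
    truncate M x = embed (Fin.val : Fin n → ℕ) Fin.val_injective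
      (WithLp.toLp 2 fun i : Fin n => if i.val < M then x i.val else 0) := by
  rw [embed_apply]
  simp only [ite_smul, zero_smul]
  rw [Fin.sum_univ_eq_sum_range (fun i => if i < M then x i • e i else 0) n, ← Finset.sum_filter,
    truncate]
  congr 1
  ext i
  simp only [Finset.mem_range, Finset.mem_filter]
  omega

/-- Compactness: the compressions of `S` to the first `n` coordinates have colorings with the same
finite set of colors and the same constant, and these converge pointwise along a nonprincipal
ultrafilter. -/
lemma EqualNormPaves.exists_coloring_of_isSelfAdjoint_L2 {δ ε : ℝ} {r : ℕ}
    (h : EqualNormPaves δ ε r) {p : ℕ} (hp : 0 < p) (hpδ : 1 / (p + 1 : ℝ) ≤ δ)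
    {S : L2 →L[ℂ] L2} (hS : IsSelfAdjoint S) (hS1 : ‖S‖ ≤ 1)
    (hd : ∀ i, ⟪e i, S (e i)⟫_ℂ = 0) :
    ∃ g : ℕ → Fin p × Fin r, ∀ j, ∀ x y : L2, (∀ i, g i ≠ j → x i = 0) →
      (∀ i, g i ≠ j → y i = 0) →
        ‖⟪y, S x⟫_ℂ‖ ≤ √((p + 1) / p * (1 - ε)) * ‖x‖ * ‖y‖ := by
  set c := √((p + 1) / p * (1 - ε))
  let J : ∀ n, L2n n →ₗᵢ[ℂ] L2 := fun n => embed Fin.val Fin.val_injective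
  have hfin : ∀ n, ∃ g : Fin n → Fin p × Fin r, ∀ j, ∀ x y : L2n n, (∀ i, g i ≠ j → x i = 0) →
      (∀ i, g i ≠ j → y i = 0) → ‖⟪J n y, S (J n x)⟫_ℂ‖ ≤ c * ‖x‖ * ‖y‖ := by
    intro n
    obtain ⟨Sn, hSn⟩ : ∃ Sn : L2n n →L[ℂ] L2n n,
        Sn = (ContinuousLinearMap.adjoint (J n).toContinuousLinearMap).comp
          (S.comp (J n).toContinuousLinearMap) := ⟨_, rfl⟩
    have hin : ∀ x y, ⟪y, Sn x⟫_ℂ = ⟪J n y, S (J n x)⟫_ℂ := fun x y => by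
      rw [hSn, ContinuousLinearMap.comp_apply, ContinuousLinearMap.adjoint_inner_right]
      rfl
    have hself : IsSelfAdjoint Sn := by
      rw [ContinuousLinearMap.isSelfAdjoint_iff_isSymmetric]
      intro x y
      change ⟪Sn x, y⟫_ℂ = ⟪x, Sn y⟫_ℂ
      rw [hin, ← inner_conj_symm, hin, inner_conj_symm, ← ContinuousLinearMap.adjoint_inner_right,
        ← ContinuousLinearMap.star_eq_adjoint, hS.star_eq]
    have hnorm : ‖Sn‖ ≤ 1 := by
      refine ContinuousLinearMap.opNorm_le_bound _ zero_le_one fun x => ?_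
      have h1 : ‖Sn x‖ ^ 2 ≤ ‖Sn x‖ * ‖x‖ := by
        rw [← re_inner_self, hin]
        calc _ ≤ ‖⟪J n (Sn x), S (J n x)⟫_ℂ‖ := Complex.re_le_norm _
          _ ≤ ‖J n (Sn x)‖ * ‖S (J n x)‖ := norm_inner_le_norm _ _
          _ ≤ ‖Sn x‖ * ‖x‖ := by
            rw [LinearIsometry.norm_map]
            gcongr
            simpa using S.le_of_opNorm_le hS1 (J n x)
      rw [one_mul]
      by_contra! hlt
      have h2 : 0 < ‖Sn x‖ := (norm_nonneg _).trans_lt hlt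
      nlinarith
    obtain ⟨g, hg⟩ := h.exists_coloring_of_isSelfAdjoint hp hpδ hself hnorm fun i => by
      rw [hin, embed_en, hd]
    exact ⟨g, fun j x y hx hy => by rw [← hin]; exact hg j x y hx hy⟩
  choose gn hgn using hfin
  let U : Ultrafilter ℕ := hyperfilter ℕ
  have hU : ∀ M : ℕ, ∀ᶠ n in (U : Filter ℕ), M ≤ n := fun M =>
    Nat.hyperfilter_le_atTop (eventually_ge_atTop M)
  have hlim : ∀ i : ℕ, ∃ k, ∀ᶠ n in (U : Filter ℕ), ∃ hi : i < n, gn n ⟨i, hi⟩ = k := by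
    intro i
    refine Ultrafilter.eventually_exists_iff.1 ?_
    filter_upwards [hU (i + 1)] with n hn
    exact ⟨_, hn, rfl⟩
  choose g hg using hlim
  refine ⟨g, fun j x y hx hy => ?_⟩
  -- Some `n ≥ M` has a coloring that agrees with `g` on all coordinates below `M`; truncating at
  -- `M` hides the others.
  have hM : ∀ M, ‖⟪truncate M y, S (truncate M x)⟫_ℂ‖ ≤ c * ‖truncate M x‖ * ‖truncate M y‖ := by
    intro M
    have hev : ∀ᶠ n in (U : Filter ℕ), ∀ i ∈ Finset.range M, ∃ hi : i < n, gn n ⟨i, hi⟩ = g i :=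
      (Finset.eventually_all _).2 fun i _ => hg i
    obtain ⟨n, hn, hMn⟩ := (hev.and (hU M)).exists
    have key : ∀ z : L2, (∀ i, g i ≠ j → z i = 0) → ∀ i : Fin n, gn n i ≠ j →
        (WithLp.toLp 2 fun i : Fin n => if i.val < M then z i.val else 0 : L2n n) i = 0 := by
      intro z hz i hi
      change (if i.val < M then z i.val else 0) = 0
      split_ifs with hiM
      · obtain ⟨_, h1⟩ := hn i.val (Finset.mem_range.2 hiM)
        exact hz _ (h1 ▸ hi)
      · rfl
    rw [truncate_eq_embed hMn x, truncate_eq_embed hMn y, LinearIsometry.norm_map,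
      LinearIsometry.norm_map]
    exact hgn n j _ _ (key x hx) (key y hy)
  have hx' := tendsto_truncate x
  have hy' := tendsto_truncate y
  exact le_of_tendsto_of_tendsto' (hy'.inner ((S.continuous.tendsto x).comp hx')).norm
    ((hx'.norm.const_mul c).mul hy'.norm) hM

lemma norm_coordProj_apply_le (A : Set ℕ) (x : L2) : ‖coordProj A x‖ ≤ ‖x‖ := by
  have := norm_le_of_forall_norm_apply_le (x := x) (y := coordProj A x) zero_le_one fun i => by
    rw [coordProj_apply]
    split_ifs <;> simp
  simpa using this

lemma inner_coordProj_left (A : Set ℕ) (x y : L2) :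
    ⟪coordProj A x, y⟫_ℂ = ⟪x, coordProj A y⟫_ℂ := by
  rw [← ContinuousLinearMap.adjoint_inner_right, ← ContinuousLinearMap.star_eq_adjoint,
    isSelfAdjoint_coordProj]

lemma norm_coordProj_mul_mul_le {A : Set ℕ} {S : L2 →L[ℂ] L2} {c : ℝ} (hc : 0 ≤ c)
    (h : ∀ x y : L2, (∀ i ∉ A, x i = 0) → (∀ i ∉ A, y i = 0) → ‖⟪y, S x⟫_ℂ‖ ≤ c * ‖x‖ * ‖y‖) :
    ‖coordProj A * S * coordProj A‖ ≤ c := by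
  refine ContinuousLinearMap.opNorm_le_bound _ hc fun x => ?_
  have hsupp : ∀ z : L2, ∀ i ∉ A, coordProj A z i = 0 := fun z i hi => by
    rw [coordProj_apply, if_neg hi]
  rw [mul_apply_eq_comp, mul_apply_eq_comp]
  set z := coordProj A (S (coordProj A x)) with hz
  have h1 : ‖z‖ ^ 2 ≤ c * ‖x‖ * ‖z‖ := by
    have h2 := h (coordProj A x) (coordProj A z) (hsupp _) (hsupp _)
    rw [inner_coordProj_left, ← hz, inner_self_eq_norm_sq_to_K, norm_pow] at h2
    have h3 : ‖z‖ ^ 2 ≤ c * ‖coordProj A x‖ * ‖coordProj A z‖ := by simpa using h2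
    refine h3.trans ?_
    gcongr <;> exact norm_coordProj_apply_le _ _
  by_contra! hlt
  have h2 : 0 < ‖z‖ := (by positivity : 0 ≤ c * ‖x‖).trans_lt hlt
  nlinarith

/-! ### Pure states of the diagonal algebra -/

/-- The diagonal projection `Q_A` as an element of `𝔻`. -/
def coordProjD (A : Set ℕ) : diagonalAlgebra := ⟨coordProj A, coordProj_mem A⟩

open Classical in
lemma inner_e_coordProjD_mul (A : Set ℕ) (T : diagonalAlgebra) (i : ℕ) :
    ⟪e i, ((coordProjD A * T : diagonalAlgebra) : L2 →L[ℂ] L2) (e i)⟫_ℂ =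
      if i ∈ A then ⟪e i, (T : L2 →L[ℂ] L2) (e i)⟫_ℂ else 0 := by
  change ⟪e i, coordProj A ((T : L2 →L[ℂ] L2) (e i))⟫_ℂ = _
  rw [inner_e_left, coordProj_apply, inner_e_left]

lemma coordProjD_mul_nonneg (A : Set ℕ) {T : diagonalAlgebra} (hT : 0 ≤ T) :
    0 ≤ coordProjD A * T :=
  diagonalAlgebra_nonneg fun i => by
    rw [inner_e_coordProjD_mul]
    split_ifs
    · exact ((diagonalAlgebra_nonneg_iff T).1 hT).inner_nonneg_right _
    · exact le_rfl

lemma coordProjD_mul_self (A : Set ℕ) : coordProjD A * coordProjD A = coordProjD A :=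
  Subtype.ext (coordProj_mul_self A)

lemma coordProjD_add_compl (A : Set ℕ) : coordProjD A + coordProjD Aᶜ = 1 :=
  Subtype.ext (coordProj_add_compl A)

lemma coordProjD_nonneg (A : Set ℕ) : 0 ≤ coordProjD A := by
  have h1 : (0 : diagonalAlgebra) ≤ 1 := diagonalAlgebra_nonneg fun i => by
    change 0 ≤ ⟪e i, e i⟫_ℂ
    rw [inner_self_eq_norm_sq_to_K, norm_e]
    simp
  simpa using coordProjD_mul_nonneg A h1

/-- The state `φ` conditioned on `A`. A state is the convex combination of its conditionings on `A`
and `Aᶜ`, which is how purity will force the values 0 and 1. -/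
lemma state_compress_mem {φ : diagonalAlgebra →ₗ[ℂ] ℂ} (hφ : φ ∈ states diagonalAlgebra)
    {A : Set ℕ} (hA : φ (coordProjD A) ≠ 0) :
    (φ (coordProjD A))⁻¹ • φ.comp (LinearMap.mulLeft ℂ (coordProjD A)) ∈
      states diagonalAlgebra := by
  refine ⟨?_, fun T hT => ?_⟩
  · simp [hA]
  · have h1 := hφ.2 _ (coordProjD_mul_nonneg A hT)
    have h2 := hφ.2 _ (coordProjD_nonneg A)
    have h3 : 0 ≤ (φ (coordProjD A))⁻¹ := inv_nonneg.2 h2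
    exact mul_nonneg h3 h1

/-- A pure state of `𝔻` takes only the values `0` and `1` at the diagonal projections. -/
lemma pureStates_coordProjD {φ : diagonalAlgebra →ₗ[ℂ] ℂ} (hφ : φ ∈ pureStates diagonalAlgebra)
    (A : Set ℕ) : φ (coordProjD A) = 0 ∨ φ (coordProjD A) = 1 := by
  by_contra! hne
  obtain ⟨h0, h1⟩ := hne
  have hsum : φ (coordProjD A) + φ (coordProjD Aᶜ) = 1 := by
    rw [← map_add, coordProjD_add_compl, hφ.1.1]
  have hc0 : φ (coordProjD Aᶜ) ≠ 0 := fun h => h1 (by simpa [h] using hsum)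
  have hA := hφ.1.2 _ (coordProjD_nonneg A)
  have hAc := hφ.1.2 _ (coordProjD_nonneg Aᶜ)
  obtain ⟨a, ha⟩ : ∃ a : ℝ, φ (coordProjD A) = a :=
    ⟨_, Complex.ext rfl (by simpa using (Complex.nonneg_iff.1 hA).2.symm)⟩
  obtain ⟨b, hb⟩ : ∃ b : ℝ, φ (coordProjD Aᶜ) = b :=
    ⟨_, Complex.ext rfl (by simpa using (Complex.nonneg_iff.1 hAc).2.symm)⟩
  have ha' : 0 < a := by
    rw [ha] at hA h0
    exact lt_of_le_of_ne (by exact_mod_cast hA) fun h => h0 (by rw [← h]; simp)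
  have hb' : 0 < b := by
    rw [hb] at hAc hc0
    exact lt_of_le_of_ne (by exact_mod_cast hAc) fun h => hc0 (by rw [← h]; simp)
  have hab : a + b = 1 := by
    rw [ha, hb] at hsum
    exact_mod_cast hsum
  have hext := hφ.2 (state_compress_mem hφ.1 h0) (state_compress_mem hφ.1 hc0)
    ⟨a, b, ha', hb', hab, by
      refine LinearMap.ext fun T => ?_
      change (a : ℂ) * ((φ (coordProjD A))⁻¹ * φ (coordProjD A * T)) +
        (b : ℂ) * ((φ (coordProjD Aᶜ))⁻¹ * φ (coordProjD Aᶜ * T)) = φ T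
      rw [← ha, ← hb, mul_inv_cancel_left₀ h0, mul_inv_cancel_left₀ hc0, ← map_add, ← add_mul,
        coordProjD_add_compl, one_mul]⟩
  -- Purity has identified `φ` with its conditioning on `A`, whose value at `Q_A` is 1.
  have h2 := LinearMap.congr_fun hext (coordProjD A)
  refine h1 (h2.symm.trans ?_)
  change (φ (coordProjD A))⁻¹ * φ (coordProjD A * coordProjD A) = 1
  rw [coordProjD_mul_self, inv_mul_cancel₀ h0]

lemma sum_coordProjD {ι : Type*} [Fintype ι] (g : ℕ → ι) :
    ∑ k, coordProjD (g ⁻¹' {k}) = 1 := by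
  classical
  refine Subtype.ext (eq_of_mem_diagonalAlgebra (Subtype.prop _) (Subtype.prop _) fun i => ?_)
  rw [AddSubmonoidClass.coe_finsetSum, _root_.sum_apply, inner_sum]
  change ∑ k, ⟪e i, coordProj (g ⁻¹' {k}) (e i)⟫_ℂ = ⟪e i, e i⟫_ℂ
  simp only [inner_e_left, coordProj_apply, Set.mem_preimage, Set.mem_singleton_iff]
  simp

/-- A pure state of `𝔻` picks a color class of each finite coloring. -/
lemma exists_coordProjD_eq_one {φ : diagonalAlgebra →ₗ[ℂ] ℂ} (hφ : φ ∈ pureStates diagonalAlgebra)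
    {ι : Type*} [Fintype ι] (g : ℕ → ι) : ∃ k, φ (coordProjD (g ⁻¹' {k})) = 1 := by
  by_contra! hne
  have h1 : φ (∑ k, coordProjD (g ⁻¹' {k})) = 0 := by
    rw [map_sum]
    exact Finset.sum_eq_zero fun k _ => (pureStates_coordProjD hφ _).resolve_right (hne k)
  rw [sum_coordProjD, hφ.1.1] at h1
  exact one_ne_zero h1

/-! ### From pavings to Kadison-Singer -/

/-- The complementary projection has value 0, so Cauchy-Schwarz annihilates every product with it as
first or last factor. -/
lemma map_coordProj_mul_mul {ψ : (L2 →L[ℂ] L2) →ₗ[ℂ] ℂ} (hψ : ψ ∈ states (L2 →L[ℂ] L2))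
    {A : Set ℕ} (hA : ψ (coordProj A) = 1) (S : L2 →L[ℂ] L2) :
    ψ (coordProj A * S * coordProj A) = ψ S := by
  have h0 : ψ (coordProj Aᶜ) = 0 := by
    have := congrArg ψ (coordProj_add_compl A)
    rw [map_add, hA, hψ.1] at this
    simpa using this
  have hstar : star (coordProj Aᶜ) = coordProj Aᶜ := isSelfAdjoint_coordProj _
  have h1 : ψ (star (coordProj Aᶜ) * coordProj Aᶜ) = 0 := by
    rw [hstar, coordProj_mul_self, h0]
  have key := map_star_mul_eq_zero ψ (states_star_mul_self_nonneg hψ) h1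
  have h2 : ψ (coordProj Aᶜ * S) = 0 := by
    have := (key S).2
    rwa [hstar] at this
  have h3 : ψ (coordProj A * S * coordProj Aᶜ) = 0 := by
    have := (key (star (coordProj A * S))).1
    rwa [star_star] at this
  have h4 : S = coordProj A * S * coordProj A + coordProj A * S * coordProj Aᶜ +
      coordProj Aᶜ * S := by
    rw [← mul_add, coordProj_add_compl, mul_one, ← add_mul, coordProj_add_compl, one_mul]
  conv_rhs => rw [h4]
  rw [map_add, map_add, h2, h3, add_zero, add_zero]

/-- If self-adjoint contractions with zero diagonal can be paved with a factor `c < 1`, each state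
which extends a pure state of `𝔻` vanishes at the self-adjoint operators with zero diagonal. -/
lemma map_eq_zero_of_isSelfAdjoint {p r : ℕ} {c : ℝ} (hc0 : 0 < c) (hc1 : c < 1)
    (hpave : ∀ S : L2 →L[ℂ] L2, IsSelfAdjoint S → ‖S‖ ≤ 1 → (∀ i, ⟪e i, S (e i)⟫_ℂ = 0) →
      ∃ g : ℕ → Fin p × Fin r, ∀ k,
        ‖coordProj (g ⁻¹' {k}) * S * coordProj (g ⁻¹' {k})‖ ≤ c)
    {φ : diagonalAlgebra →ₗ[ℂ] ℂ} (hφ : φ ∈ pureStates diagonalAlgebra)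
    {ψ : (L2 →L[ℂ] L2) →ₗ[ℂ] ℂ} (hψ : ψ ∈ states (L2 →L[ℂ] L2)) (hext : Extends ψ φ)
    {S : L2 →L[ℂ] L2} (hS : IsSelfAdjoint S) (hd : ∀ i, ⟪e i, S (e i)⟫_ℂ = 0) : ψ S = 0 := by
  have hreal : ∀ a : ℝ, IsSelfAdjoint (a : ℂ) := fun a => Complex.conj_ofReal a
  have hsmul : ∀ (a : ℝ) (T : L2 →L[ℂ] L2), 0 ≤ a → ‖(a : ℂ) • T‖ = a * ‖T‖ := fun a T ha => by
    rw [norm_smul, Complex.norm_real, Real.norm_of_nonneg ha]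
  have hpow : ∀ N : ℕ, ∀ T : L2 →L[ℂ] L2, IsSelfAdjoint T → ‖T‖ ≤ 1 →
      (∀ i, ⟪e i, T (e i)⟫_ℂ = 0) → ‖ψ T‖ ≤ c ^ N := by
    intro N
    induction N with
    | zero =>
      intro T hT hT1 _
      rw [pow_zero]
      exact (norm_map_le_of_isSelfAdjoint hψ hT).trans hT1
    | succ N ih =>
      intro T hT hT1 hTd
      obtain ⟨g, hg⟩ := hpave T hT hT1 hTd
      obtain ⟨k, hk⟩ := exists_coordProjD_eq_one hφ g
      have hk' : ψ (coordProj (g ⁻¹' {k})) = 1 := (hext (coordProjD (g ⁻¹' {k}))).trans hk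
      obtain ⟨Z, hZ⟩ : ∃ Z, Z = coordProj (g ⁻¹' {k}) * T * coordProj (g ⁻¹' {k}) := ⟨_, rfl⟩
      have hZn : ‖Z‖ ≤ c := hZ ▸ hg k
      have hZs : IsSelfAdjoint Z := by
        rw [hZ, IsSelfAdjoint, star_mul, star_mul, (isSelfAdjoint_coordProj _).star_eq, hT.star_eq,
          mul_assoc]
      have hZd : ∀ i, ⟪e i, Z (e i)⟫_ℂ = 0 := by
        classical
        intro i
        have h1 : coordProj (g ⁻¹' {k}) (e i) = if i ∈ g ⁻¹' {k} then e i else 0 := by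
          ext m
          rw [coordProj_apply]
          by_cases hmi : m = i
          · subst hmi
            split_ifs <;> rfl
          · split_ifs <;> simp [e, lp.single_apply, hmi]
        rw [hZ, mul_apply_eq_comp, mul_apply_eq_comp, ← inner_coordProj_left, h1]
        split_ifs
        · exact hTd i
        · exact inner_zero_left _
      -- The compressed operator rescaled by `c⁻¹` is again a self-adjoint contraction with zero
      -- diagonal, so the paving can be iterated; each round gains a factor `c`.
      have h1 := ih (((c⁻¹ : ℝ) : ℂ) • Z) ((hreal _).smul hZs)
        (by rw [hsmul _ _ (by positivity), inv_mul_le_iff₀ hc0, mul_one]; exact hZn)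
        (fun i => by rw [_root_.smul_apply, inner_smul_right, hZd, mul_zero])
      rw [map_smul, smul_eq_mul, norm_mul, Complex.norm_real, Real.norm_of_nonneg (by positivity),
        inv_mul_le_iff₀ hc0, hZ, map_coordProj_mul_mul hψ hk'] at h1
      rwa [pow_succ']
  have hn : 0 < ‖S‖ + 1 := by positivity
  have h1 : ψ ((((‖S‖ + 1)⁻¹ : ℝ) : ℂ) • S) = 0 := by
    rw [← norm_le_zero_iff]
    refine ge_of_tendsto' (tendsto_pow_atTop_nhds_zero_of_lt_one hc0.le hc1) fun N =>
      hpow N _ ((hreal _).smul hS) ?_ fun i => by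
        rw [_root_.smul_apply, inner_smul_right, hd, mul_zero]
    rw [hsmul _ _ (by positivity), inv_mul_le_iff₀ hn]
    linarith
  rw [map_smul, smul_eq_mul] at h1
  refine (mul_eq_zero.1 h1).resolve_left ?_
  exact_mod_cast (inv_pos.2 hn).ne'

lemma inner_e_star (S : L2 →L[ℂ] L2) (i : ℕ) :
    ⟪e i, star S (e i)⟫_ℂ = star ⟪e i, S (e i)⟫_ℂ := by
  rw [ContinuousLinearMap.star_eq_adjoint, ContinuousLinearMap.adjoint_inner_right]
  exact (inner_conj_symm _ _).symm

/-- A functional that vanishes at self-adjoint operators with zero diagonal is determined by its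
restriction to `𝔻`. -/
lemma map_eq_map_diagPart {ψ : (L2 →L[ℂ] L2) →ₗ[ℂ] ℂ} {φ : diagonalAlgebra →ₗ[ℂ] ℂ}
    (hext : Extends ψ φ)
    (h : ∀ S : L2 →L[ℂ] L2, IsSelfAdjoint S → (∀ i, ⟪e i, S (e i)⟫_ℂ = 0) → ψ S = 0)
    (T : L2 →L[ℂ] L2) : ψ T = φ (diagPart T) := by
  obtain ⟨S, hS⟩ : ∃ S, S = T - (diagPart T : L2 →L[ℂ] L2) := ⟨_, rfl⟩
  have hd : ∀ i, ⟪e i, S (e i)⟫_ℂ = 0 := fun i => by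
    rw [hS, _root_.sub_apply, inner_sub_right, inner_e_diagPart, sub_self]
  -- `S + S⋆` and `I (S - S⋆)` are self-adjoint with zero diagonal, and together they determine `ψ
  -- S`.
  have h1 : ψ (S + star S) = 0 := h _ (IsSelfAdjoint.add_star_self S) fun i => by
    rw [_root_.add_apply, inner_add_right, inner_e_star, hd, star_zero, add_zero]
  have h2 : ψ (Complex.I • (S - star S)) = 0 := by
    refine h _ ?_ fun i => ?_
    · rw [IsSelfAdjoint, star_smul, star_sub, star_star, Complex.star_def, Complex.conj_I, neg_smul,
        ← smul_neg, neg_sub]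
    · rw [_root_.smul_apply, inner_smul_right, _root_.sub_apply, inner_sub_right, inner_e_star, hd,
        star_zero, sub_zero, mul_zero]
  rw [map_add] at h1
  rw [map_smul, map_sub, smul_eq_mul] at h2
  have h3 := (mul_eq_zero.1 h2).resolve_left Complex.I_ne_zero
  have h4 : ψ S = 0 := by linear_combination (h1 + h3) / 2
  rw [hS, map_sub, hext] at h4
  exact sub_eq_zero.1 h4

/-- A state of `𝔻` extends to a state of `B(ℓ₂)` by composition with the diagonal part. -/
lemma comp_diagPart_mem_states {φ : diagonalAlgebra →ₗ[ℂ] ℂ} (hφ : φ ∈ states diagonalAlgebra) :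
    φ.comp diagPart ∈ states (L2 →L[ℂ] L2) := by
  refine ⟨?_, fun T hT => hφ.2 _ (diagPart_nonneg hT)⟩
  rw [LinearMap.comp_apply]
  exact (congrArg φ (diagPart_coe 1)).trans hφ.1

/-- If a pure state of `𝔻` has a unique extension to a state, this extension is pure. -/
lemma mem_pureStates_of_unique_extension {φ : diagonalAlgebra →ₗ[ℂ] ℂ}
    (hφ : φ ∈ pureStates diagonalAlgebra) {ψ : (L2 →L[ℂ] L2) →ₗ[ℂ] ℂ}
    (hψ : ψ ∈ states (L2 →L[ℂ] L2)) (hext : Extends ψ φ)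
    (huniq : ∀ ψ' ∈ states (L2 →L[ℂ] L2), Extends ψ' φ → ψ' = ψ) :
    ψ ∈ pureStates (L2 →L[ℂ] L2) := by
  refine ⟨hψ, ?_⟩
  rintro f₁ hf₁ f₂ hf₂ ⟨a, b, ha, hb, hab, hf⟩
  refine huniq f₁ hf₁ fun T => ?_
  -- Purity of `φ` makes each part of a convex decomposition of `ψ` extend `φ` too, so uniqueness
  -- applies to it.
  have h1 : restrict f₁ = φ := hφ.2 (restrict_mem_states hf₁) (restrict_mem_states hf₂)
    ⟨a, b, ha, hb, hab, LinearMap.ext fun T => by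
      rw [← hext T, ← hf]
      rfl⟩
  exact LinearMap.congr_fun h1 T

theorem EqualNormPavingConjecture.kadisonSinger (hP : EqualNormPavingConjecture) : KS := by
  obtain ⟨δ, ε, r, hδ, hδε, hε1, hpaves⟩ := hP
  have h : EqualNormPaves δ ε r := hpaves
  have hε : 0 < ε := (Real.sqrt_pos.2 hδ).trans_le hδε
  -- `p > 1/δ` makes the diagonal `1/(p+1)` admissible, and `p > 1/ε` keeps `(p+1)/p * (1 - ε)`
  -- below 1 despite the rescaling loss.
  obtain ⟨p, hp⟩ := exists_nat_gt (max (1 / δ) (1 / ε))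
  have hpδ' : 1 / δ < p := (le_max_left _ _).trans_lt hp
  have hpε' : 1 / ε < p := (le_max_right _ _).trans_lt hp
  have hp0 : (0 : ℝ) < p := (by positivity : 0 < 1 / δ).trans hpδ'
  have hp0' : 0 < p := by exact_mod_cast hp0
  have hpδ : 1 / (p + 1 : ℝ) ≤ δ := by
    rw [div_lt_iff₀ hδ] at hpδ'
    rw [div_le_iff₀ (by positivity)]
    nlinarith
  have hc0 : 0 < (p + 1) / p * (1 - ε) := mul_pos (by positivity) (sub_pos.2 hε1)
  have hc1 : (p + 1) / p * (1 - ε) < 1 := by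
    rw [div_lt_iff₀ hε] at hpε'
    rw [div_mul_eq_mul_div, div_lt_one hp0]
    nlinarith
  have hpave : ∀ S : L2 →L[ℂ] L2, IsSelfAdjoint S → ‖S‖ ≤ 1 → (∀ i, ⟪e i, S (e i)⟫_ℂ = 0) →
      ∃ g : ℕ → Fin p × Fin r, ∀ k,
        ‖coordProj (g ⁻¹' {k}) * S * coordProj (g ⁻¹' {k})‖ ≤ √((p + 1) / p * (1 - ε)) := by
    intro S hS hS1 hd
    obtain ⟨g, hg⟩ := h.exists_coloring_of_isSelfAdjoint_L2 hp0' hpδ hS hS1 hd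
    exact ⟨g, fun k => norm_coordProj_mul_mul_le (Real.sqrt_nonneg _) fun x y hx hy =>
      hg k x y hx hy⟩
  intro φ hφ
  have huniq : ∀ ψ' ∈ states (L2 →L[ℂ] L2), Extends ψ' φ → ψ' = φ.comp diagPart :=
    fun ψ' hψ' hext' => LinearMap.ext fun T => map_eq_map_diagPart hext' (fun S hS hd =>
      map_eq_zero_of_isSelfAdjoint (Real.sqrt_pos.2 hc0)
        ((Real.sqrt_lt_sqrt hc0.le hc1).trans_eq Real.sqrt_one) hpave hφ hψ' hext' hS hd) T
  have hext : Extends (φ.comp diagPart) φ := fun T => congrArg φ (diagPart_coe T)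
  have hst := comp_diagPart_mem_states hφ.1
  exact ⟨_, mem_pureStates_of_unique_extension hφ hst hext huniq, hext, huniq⟩

end KadisonSinger

end

theorem mainTheorem10 :
    KadisonSinger.KS ↔ KadisonSinger.EqualNormPavingConjecture :=
  ⟨KadisonSinger.KS.equalNormPavingConjecture,
    KadisonSinger.EqualNormPavingConjecture.kadisonSinger⟩
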